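/- Work over $\mathbb{C}$. Let $X$ be a smooth Deligne--Mumford stack over $\mathbb{C}$ (for example, a smooth scheme; the diagonal of $X$ is assumed to be representable by schemes), and let $D \subset X$ be an effective Cartier divisor. Let $\mathscr{A} = [\mathbb{A}^1/\mathbb{G}_m]$ be the quotient stack, i.e. the stack of line bundles with a section: an object of $\mathscr{A}$ over a $\mathbb{C}$-scheme $T$ is a $\mathbb{G}_m$-torsor $P \to T$ with a $\mathbb{G}_m$-equivariant morphism $P \to \mathbb{A}^1$. Let $\sigma : X \to \mathscr{A}$ be the morphism that corresponds to the line bundle with section $(\mathcal{O}_X(D), 1)$, that is, to the line bundle with a section whose zero scheme is $D$ (it is unique up to a unique isomorphism). Then the morphism $\sigma$ is smooth if and only if $D$ is smooth over $\mathbb{C}$. -/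

import Mathlib

open CategoryTheory AlgebraicGeometry Opposite Limits
open scoped CategoryTheory.Pseudofunctor CategoryTheory.BasedFunctor CategoryTheory.Bicategory

universe v u

/-- The category of schemes over `ℂ`. -/
abbrev SchC : Type 1 := Over (Spec (CommRingCat.of ℂ))

/-- The big étale topology on schemes over `ℂ`. -/
noncomputable abbrev etaleTopologyC : GrothendieckTopology SchC :=
  Scheme.etaleTopology.over (Spec (CommRingCat.of ℂ))

/-! ### Representable morphisms from schemes to stacks

A category fibred in groupoids over `SchC` is given as a `BasedCategory SchC`.  By the 2-Yoneda
lemma an object `x` lying over a scheme `U` is the same as a morphism `x : U ⟶ 𝒳`. -/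

/-- The morphism `x : U ⟶ 𝒳` is representable by schemes, and all its base changes have the
property `P`: for every scheme `T` and every morphism `y : T ⟶ 𝒳` the 2-fibre product
`U ×_𝒳 T` is represented by a scheme, and the projection `U ×_𝒳 T ⟶ T` has `P`.

A point of `U ×_𝒳 T` with values in a scheme `V` is a triple `(f : V ⟶ U, g : V ⟶ T, f^* x ≅ g^* y)`,
and this is the same as an object `v` of `𝒳` over `V` with two morphisms `v ⟶ x` and `v ⟶ y`, up to
isomorphism.  So the scheme `W` represents `U ×_𝒳 T` if and only if `x` and `y` have, in the total
category of `𝒳`, a product `w` which lies over `W`. -/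
def IsRepresentableWith (P : MorphismProperty Scheme.{0}) {𝒳 : BasedCategory.{v, u} SchC}
    (x : 𝒳.obj) : Prop :=
  ∀ y : 𝒳.obj, ∃ (w : 𝒳.obj) (a : w ⟶ x) (b : w ⟶ y),
    Nonempty (IsLimit (BinaryFan.mk a b)) ∧ P (𝒳.p.map b).left

/-- An étale chart: a morphism `x : U ⟶ 𝒳` from a scheme that is representable and étale. -/
def IsEtaleChart {𝒳 : BasedCategory.{v, u} SchC} (x : 𝒳.obj) : Prop :=
  IsRepresentableWith @Etale x

/-- An étale atlas: a morphism `x : U ⟶ 𝒳` from a scheme that is representable, étale and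
surjective. -/
def IsEtaleAtlas {𝒳 : BasedCategory.{v, u} SchC} (x : 𝒳.obj) : Prop :=
  IsRepresentableWith (@Etale ⊓ @Surjective) x

/-- The category fibred over `SchC` that is attached to a pseudofunctor. -/
noncomputable def totalBased (F : LocallyDiscrete SchCᵒᵖ ⥤ᵖ Cat.{v, u}) : BasedCategory SchC :=
  BasedCategory.ofFunctor (Pseudofunctor.CoGrothendieck.forget F)

/-- A Deligne--Mumford stack over `ℂ`: a stack in groupoids for the étale topology whose diagonal is
representable (by schemes) and which has an étale atlas.

The diagonal is representable if and only if all fibre products `U ×_𝒳 T` of schemes over `𝒳` are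
representable, that is, if and only if any two objects of the total category have a product. -/
structure DMStack where
  /-- the groupoids of sections and their pullback functors -/
  sections : LocallyDiscrete SchCᵒᵖ ⥤ᵖ Cat.{v, u}
  isGroupoid : ∀ T : LocallyDiscrete SchCᵒᵖ, IsGroupoid (sections.obj T)
  isStack : sections.IsStack etaleTopologyC
  diagonal : ∀ x y : (totalBased sections).obj, HasBinaryProduct x y
  atlas : ∃ x : (totalBased sections).obj, IsEtaleAtlas x

/-- A Deligne--Mumford stack as a category fibred in groupoids over `SchC`. -/
noncomputable abbrev DMStack.fib (X : DMStack.{v, u}) : BasedCategory SchC := totalBased X.sections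

/-- `X` is smooth over `ℂ`: every scheme that is étale over `X` is smooth over `ℂ`. -/
def DMStack.IsSmooth (X : DMStack.{v, u}) : Prop :=
  ∀ x : X.fib.obj, IsEtaleChart x → Smooth (X.fib.p.obj x).hom

/-- A morphism `F : X ⟶ 𝒴` from a Deligne--Mumford stack to a category fibred in groupoids (with
diagonal representable by schemes) is smooth: for every étale chart `U ⟶ X` the composition
`U ⟶ X ⟶ 𝒴` is representable and smooth. -/
def IsSmoothMorphism {X : DMStack.{v, u}} {𝒴 : BasedCategory.{0, 1} SchC} (F : X.fib ⥤ᵇ 𝒴) : Prop :=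
  ∀ x : X.fib.obj, IsEtaleChart x → IsRepresentableWith @Smooth (F.obj x)

/-! ### Closed substacks and effective Cartier divisors -/

/-- A closed subscheme, given by its ideal sheaf, is an effective Cartier divisor: its ideal sheaf
is locally generated by one element that is not a zero divisor. -/
def IsEffectiveCartierIdeal {U : Scheme.{0}} (I : U.IdealSheafData) : Prop :=
  ∀ z : U, ∃ W : U.affineOpens, z ∈ W.1 ∧
    ∃ f ∈ nonZeroDivisors Γ(U, W.1), I.ideal W = Ideal.span {f}

/-- A closed substack `D` of `X`: for every morphism `x : T ⟶ X` from a scheme the closed subscheme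
`D ×_X T` of `T` (given by its ideal sheaf), compatibly with base change. -/
structure ClosedSubstack (X : DMStack.{v, u}) where
  ideal : ∀ x : X.fib.obj, (X.fib.p.obj x).left.IdealSheafData
  comap_ideal : ∀ {x y : X.fib.obj} (f : x ⟶ y), (ideal y).comap (X.fib.p.map f).left = ideal x

/-- The closed substack `D` is an effective Cartier divisor: it is one on every étale chart. -/
def ClosedSubstack.IsEffectiveCartier {X : DMStack.{v, u}} (D : ClosedSubstack X) : Prop :=
  ∀ x : X.fib.obj, IsEtaleChart x → IsEffectiveCartierIdeal (D.ideal x)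

/-- The closed substack `D` is smooth over `ℂ`: its étale charts `D ×_X U`, for the étale charts `U`
of `X`, are smooth over `ℂ`. -/
def ClosedSubstack.IsSmooth {X : DMStack.{v, u}} (D : ClosedSubstack X) : Prop :=
  ∀ x : X.fib.obj, IsEtaleChart x → Smooth ((D.ideal x).subschemeι ≫ (X.fib.p.obj x).hom)

/-! ### The quotient stack `[𝔸¹/𝔾ₘ]`

The group scheme `𝔾ₘ` has `𝔾ₘ(V) = Γ(V, ⊤)ˣ`, and `𝔸¹` has `𝔸¹(V) = Γ(V, ⊤)`; the action of `𝔾ₘ`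
on `𝔸¹` is multiplication. -/

/-- Pullback of invertible functions, `𝔾ₘ(V) → 𝔾ₘ(V')` for `f : V' ⟶ V`. -/
noncomputable def pullUnit {V' V : Scheme.{0}} (f : V' ⟶ V) : Γ(V, ⊤)ˣ →* Γ(V', ⊤)ˣ :=
  Units.map f.appTop.hom.toMonoidHom

/-- A `𝔾ₘ`-torsor over the scheme `T`: a `T`-scheme with an action of `𝔾ₘ` over `T` (given on points
with values in schemes) which is simply transitive on the fibres and has sections locally on `T`.
Sections exist locally in the Zariski topology, as `𝔾ₘ`-torsors for the étale or the
fppf topology are the frame bundles of line bundles and therefore are Zariski locally trivial. -/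
structure GmTorsor (T : Scheme.{0}) where
  total : Scheme.{0}
  proj : total ⟶ T
  act : ∀ {V : Scheme.{0}}, Γ(V, ⊤)ˣ → (V ⟶ total) → (V ⟶ total)
  comp_act : ∀ {V' V : Scheme.{0}} (f : V' ⟶ V) (c : Γ(V, ⊤)ˣ) (q : V ⟶ total),
    f ≫ act c q = act (pullUnit f c) (f ≫ q)
  one_act : ∀ {V : Scheme.{0}} (q : V ⟶ total), act 1 q = q
  mul_act : ∀ {V : Scheme.{0}} (c d : Γ(V, ⊤)ˣ) (q : V ⟶ total), act (c * d) q = act c (act d q)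
  act_proj : ∀ {V : Scheme.{0}} (c : Γ(V, ⊤)ˣ) (q : V ⟶ total), act c q ≫ proj = q ≫ proj
  simply_transitive : ∀ {V : Scheme.{0}} (q r : V ⟶ total), q ≫ proj = r ≫ proj →
    ∃! c : Γ(V, ⊤)ˣ, act c q = r
  local_section : ∀ t : T, ∃ W : T.Opens, t ∈ W ∧ ∃ e : W.toScheme ⟶ total, e ≫ proj = W.ι

/-- An object of `[𝔸¹/𝔾ₘ]` over the scheme `T`: a `𝔾ₘ`-torsor `P` over `T` with an equivariant
morphism `P ⟶ 𝔸¹`, i.e. with a function `fn` on `P` such that `fn (c • q) = c * fn q`.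

Equivalently, a line bundle `L` on `T` with a section `s`: sections of `L` over an open `W ⊆ T` are
the functions on the preimage of `W` in `P` with this equivariance, and `s` is `fn`. -/
structure GmTorsorWithMap (T : Scheme.{0}) extends GmTorsor T where
  fn : Γ(total, ⊤)
  act_fn : ∀ {V : Scheme.{0}} (c : Γ(V, ⊤)ˣ) (q : V ⟶ total),
    (act c q).appTop.hom fn = (c : Γ(V, ⊤)) * q.appTop.hom fn

/-- Objects of the total category of `[𝔸¹/𝔾ₘ]`. -/
structure A1GmObj where
  base : SchC
  tors : GmTorsorWithMap base.left

/-- Morphisms of the total category of `[𝔸¹/𝔾ₘ]`: a morphism of the base schemes and an equivariant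
morphism of the torsors above it (so the square is cartesian), compatible with the morphisms
to `𝔸¹`. -/
@[ext]
structure A1GmHom (A B : A1GmObj) where
  base : A.base ⟶ B.base
  top : A.tors.total ⟶ B.tors.total
  top_proj : top ≫ B.tors.proj = A.tors.proj ≫ base.left
  act_top : ∀ {V : Scheme.{0}} (c : Γ(V, ⊤)ˣ) (q : V ⟶ A.tors.total),
    A.tors.act c q ≫ top = B.tors.act c (q ≫ top)
  top_fn : top.appTop.hom B.tors.fn = A.tors.fn

noncomputable instance : Category.{0} A1GmObj where
  Hom := A1GmHom
  id A :=
    { base := 𝟙 _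
      top := 𝟙 _
      top_proj := by simp
      act_top := by simp
      top_fn := by simp }
  comp f g :=
    { base := f.base ≫ g.base
      top := f.top ≫ g.top
      top_proj := by
        rw [Category.assoc, g.top_proj, ← Category.assoc, f.top_proj, Category.assoc, Over.comp_left]
      act_top := fun c q => by
        rw [← Category.assoc, f.act_top, g.act_top, Category.assoc]
      top_fn := by
        rw [Scheme.Hom.comp_appTop, CommRingCat.comp_apply, g.top_fn, f.top_fn] }
  id_comp f := A1GmHom.ext (Category.id_comp _) (Category.id_comp _)
  comp_id f := A1GmHom.ext (Category.comp_id _) (Category.comp_id _)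
  assoc f g h := A1GmHom.ext (Category.assoc _ _ _) (Category.assoc _ _ _)

/-- The quotient stack `[𝔸¹/𝔾ₘ]` over `ℂ`, as a category fibred in groupoids over `SchC`. -/
noncomputable def A1ModGm : BasedCategory.{0, 1} SchC :=
  BasedCategory.ofFunctor (𝒳 := A1GmObj)
    { obj := fun A => A.base
      map := fun f => A1GmHom.base f
      map_id := fun _ => rfl
      map_comp := fun _ _ => rfl }

/-- The torsor with equivariant map to `𝔸¹` that is the value of `σ` at `x : T ⟶ X`. -/
noncomputable def torsorAt {X : DMStack.{v, u}} (σ : X.fib ⥤ᵇ A1ModGm) (x : X.fib.obj) : A1GmObj := σ.obj x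

/-- The projection to `T` of the torsor that is the value of `σ` at `x : T ⟶ X`. -/
noncomputable def torsorProj {X : DMStack.{v, u}} (σ : X.fib ⥤ᵇ A1ModGm) (x : X.fib.obj) :
    (torsorAt σ x).tors.total ⟶ (X.fib.p.obj x).left :=
  (torsorAt σ x).tors.proj ≫ (eqToHom (σ.w_obj x)).left

/-- `σ : X ⟶ [𝔸¹/𝔾ₘ]` is the morphism given by `(𝒪(D), 1)`: the line bundle with section `(L, s)`
that corresponds to `σ` has zero scheme `D`.  For every `x : T ⟶ X`, with torsor `P ⟶ T` and function
`fn` on `P`, the zero scheme of `fn` is the preimage of the closed subscheme `D ×_X T` of `T`.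

If `D` is an effective Cartier divisor, then `(𝒪(D), 1)` is, up to a unique isomorphism, the only line
bundle with a section whose zero scheme is `D`. -/
def IsGivenByDivisor {X : DMStack.{v, u}} (σ : X.fib ⥤ᵇ A1ModGm) (D : ClosedSubstack X) : Prop :=
  ∀ (x : X.fib.obj) (W : (torsorAt σ x).tors.total.affineOpens),
    ((D.ideal x).comap (torsorProj σ x)).ideal W =
      Ideal.span {((torsorAt σ x).tors.total.presheaf.map (homOfLE (le_top : W.1 ≤ ⊤)).op).hom
        (torsorAt σ x).tors.fn}

/-!
Let `P ⟶ U` be the torsor with function `fn` that `σ` attaches to an étale chart `U` of `X`, and let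
`D ⊆ U` be the divisor. A point of `P` is a zero of `fn` if and only if it lies over `D`
(`A1GmObj.HasZeroScheme.factors_iff`). The theorem is proved chart by chart, in
`isRepresentableWith_smooth_iff`.

*If `D` is smooth.* For an object `B` over `T` with torsor `Q`, the fibre product `U ×_𝒜 T` is the
functor of isomorphisms between the pullbacks of `P` and `Q` that respect the functions
(`IsomPoint`). It is a Zariski sheaf, and over an open of `T` on which `Q` has a section it is the
fibre product over `𝔸¹` of `P` and this open. So it is representable
(`isomFunctor_isRepresentable`), and it is smooth over `T` as soon as `fn : P ⟶ 𝔸¹` is smooth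
(`exists_isLimit_binaryFan`). Locally `fn` is the function `T f` on `Spec R × 𝔾ₘ`, where `f` is a
local equation of `D`. As `R ⧸ (f)` and `R` are smooth, the conormal sequence splits and gives a
derivation `δ` of `R` and `g` in `R` with `δ f + g f = 1`. Then the derivation `T⁻¹ δ + g ∂/∂T`
takes `T f` to `1`, and therefore lifts along nilpotent thickenings of `Spec R × 𝔾ₘ` can be
corrected to respect a given value of `T f` (`smooth_laurentPolynomial_of_smooth_quotient`). The
regularity of `f` enters in the conormal sequence, where it makes `(f) / (f²)` free.

*If `σ` is smooth.* The base change `W` of `U` along the zero section `Spec ℂ ⟶ 𝒜` is smooth over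
`ℂ`. It maps to `D`, since the function of the zero section vanishes, and a local section of `P`
over an open of `D` gives a section of `W ⟶ D` there. So the local rings of `D` are retracts of
those of `W`, and a retract of a formally smooth algebra is formally smooth
(`smooth_of_locally_retract`).
-/

/-! ### Smooth algebras -/

section Algebra

open scoped LaurentPolynomial TensorProduct
open LaurentPolynomial KaehlerDifferential

/-- The conormal sequence of a smooth hypersurface `f = 0` splits, so `df` spans a direct summand of
the differentials along the hypersurface: some derivation takes `f` to `1` modulo `f`. -/
theorem exists_derivation_of_formallySmooth_quotient {k R : Type*} [CommRing k] [CommRing R]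
    [Algebra k R] [Algebra.FormallySmooth k R] {f : R} (hf : f ∈ nonZeroDivisors R)
    [Algebra.FormallySmooth k (R ⧸ Ideal.span {f})] :
    ∃ (δ : Derivation k R R) (g : R), δ f + g * f = 1 := by
  let I := RingHom.ker (algebraMap R (R ⧸ Ideal.span {f}))
  have hker : I = Ideal.span {f} := Ideal.mk_ker
  obtain ⟨l, hl⟩ : ∃ l : (R ⧸ Ideal.span {f}) ⊗[R] Ω[R⁄k] →ₗ[R] I.Cotangent,
      l ∘ₗ kerCotangentToTensor k R (R ⧸ Ideal.span {f}) = LinearMap.id :=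
    (Algebra.FormallySmooth.iff_split_injection Ideal.Quotient.mk_surjective).mp inferInstance
  have hfI : f ∈ I := by rw [hker]; exact Ideal.mem_span_singleton_self f
  let u : R →ₗ[R] I.Cotangent := LinearMap.toSpanSingleton R _ (I.toCotangent ⟨f, hfI⟩)
  have hu : Function.Surjective u := by
    intro c
    obtain ⟨⟨x, hx⟩, rfl⟩ := I.toCotangent_surjective c
    obtain ⟨a, rfl⟩ := Ideal.mem_span_singleton'.mp (hker ▸ hx)
    refine ⟨a, ?_⟩
    simp only [u, LinearMap.toSpanSingleton_apply, ← map_smul]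
    rfl
  let m : Ω[R⁄k] →ₗ[R] I.Cotangent :=
    l ∘ₗ (TensorProduct.mk R (R ⧸ Ideal.span {f}) Ω[R⁄k] 1)
  obtain ⟨q, hq⟩ := Module.projective_lifting_property u m hu
  have h1 : u (q (D k R f)) = u 1 := by
    have h2 := LinearMap.congr_fun hl (I.toCotangent ⟨f, hfI⟩)
    have h3 := LinearMap.congr_fun hq (D k R f)
    simp only [LinearMap.comp_apply, LinearMap.id_apply] at h2 h3
    rw [h3]
    simp only [u, m, LinearMap.toSpanSingleton_apply, one_smul, LinearMap.comp_apply,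
      TensorProduct.mk_apply]
    rw [← h2]
    rw [kerCotangentToTensor_toCotangent]
  have h4 : (q (D k R f) - 1) * f ∈ I ^ 2 := by
    have h5 : I.toCotangent ((q (D k R f) - 1) • ⟨f, hfI⟩) = 0 := by
      rw [map_smul, sub_smul, sub_eq_zero]
      simpa [u] using h1
    exact (I.toCotangent_eq_zero _).mp h5
  rw [hker, Ideal.span_singleton_pow, Ideal.mem_span_singleton'] at h4
  obtain ⟨a, ha⟩ := h4
  refine ⟨q.compDer (D k R), -a, ?_⟩
  have : (q (D k R f) - 1 - a * f) * f = 0 := by linear_combination -ha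
  have h6 := (mul_right_mem_nonZeroDivisors_eq_zero_iff hf).mp this
  change q (D k R f) + -a * f = 1
  linear_combination h6

/-- Let `δ` be a derivation of a formally smooth algebra `R` with `δ f + g f = 1`.  Then
`t⁻¹ δ + g ∂/∂t` is a derivation of `R[t, t⁻¹]` that takes `t f` to `1`, and so `R[t, t⁻¹]` is
formally smooth over `k[x]`, where `x` acts as `t f`. -/
theorem formallySmooth_laurentPolynomial_of_derivation {k R : Type*} [CommRing k] [CommRing R]
    [Algebra k R] [Algebra.FormallySmooth k R] {f g : R} (δ : Derivation k R R)
    (h : δ f + g * f = 1) [Algebra (MvPolynomial PUnit.{1} k) R[T;T⁻¹]]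
    [IsScalarTower k (MvPolynomial PUnit.{1} k) R[T;T⁻¹]]
    (hX : algebraMap (MvPolynomial PUnit.{1} k) R[T;T⁻¹] (.X ⟨⟩) = T 1 * C f) :
    Algebra.FormallySmooth (MvPolynomial PUnit.{1} k) R[T;T⁻¹] := by
  refine .of_comp_surjective fun Q _ _ I hI φ => ?_
  algebraize [(algebraMap (MvPolynomial PUnit.{1} k) Q).comp (algebraMap k _)]
  let x : Q := algebraMap (MvPolynomial PUnit.{1} k) Q (.X ⟨⟩)
  have hsq : ∀ a ∈ I, ∀ b ∈ I, a * b = 0 := fun a ha b hb => by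
    have := Ideal.mul_mem_mul ha hb
    rwa [← pow_two, hI] at this
  -- an arbitrary lift of the restriction of `φ` to `R`, and of `φ t`
  let φR : R →ₐ[k] Q ⧸ I :=
    (φ.restrictScalars k).comp (IsScalarTower.toAlgHom k R R[T;T⁻¹])
  obtain ⟨ρ, hρ⟩ := Algebra.FormallySmooth.comp_surjective k R I hI φR
  have hρ' (r : R) : Ideal.Quotient.mk I (ρ r) = φ (C r) := AlgHom.congr_fun hρ r
  obtain ⟨t₀, ht⟩ := Ideal.Quotient.mk_surjective (φ (T 1))
  have hunit (s : Q) (hs : Ideal.Quotient.mk I s = φ (T 1)) : IsUnit s := by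
    obtain ⟨s', hs'⟩ := Ideal.Quotient.mk_surjective (φ (T (-1)))
    have : Ideal.Quotient.mk I (s * s') = 1 := by
      rw [map_mul, hs, hs', ← map_mul, ← T_add]; simp
    have h1 : s * s' - 1 ∈ I := by
      rw [← Ideal.Quotient.eq_zero_iff_mem, map_sub, this, map_one, sub_self]
    have h2 := hsq _ h1 _ h1
    exact IsUnit.of_mul_eq_one (s' * (2 - s * s')) (by linear_combination -h2)
  obtain ⟨⟨t, t', htt', htt''⟩, hτ⟩ := hunit t₀ ht
  obtain rfl : t = t₀ := hτ
  -- the error `e₀` of this lift at `t f` is corrected with the derivation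
  let e₀ : Q := t * ρ f - x
  have he₀ : e₀ ∈ I := by
    rw [← Ideal.Quotient.eq_zero_iff_mem, map_sub, map_mul, ht, hρ', ← map_mul, ← hX, φ.commutes,
      sub_eq_zero]
    rfl
  have he₁ : t * ρ f - x = e₀ := rfl
  have he₀e₀ := hsq _ he₀ _ he₀
  let ρ' : R →ₐ[k] Q := AlgHom.ofLinearMap
    (ρ.toLinearMap - (LinearMap.mulLeft k (e₀ * t')) ∘ₗ ρ.toLinearMap ∘ₗ (δ : R →ₗ[k] R))
    (by simp) (fun a b => by
      change ρ (a * b) - e₀ * t' * ρ (δ (a * b)) =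
        (ρ a - e₀ * t' * ρ (δ a)) * (ρ b - e₀ * t' * ρ (δ b))
      simp only [Derivation.leibniz, map_add, map_mul, smul_eq_mul]
      linear_combination (-t' * t' * ρ (δ a) * ρ (δ b)) * he₀e₀)
  have hρ'' (r : R) : ρ' r = ρ r - e₀ * t' * ρ (δ r) := rfl
  have hmke₀ : Ideal.Quotient.mk I e₀ = 0 := Ideal.Quotient.eq_zero_iff_mem.mpr he₀
  have hs : Ideal.Quotient.mk I (t - e₀ * ρ g) = φ (T 1) := by
    rw [map_sub, map_mul, hmke₀, ht]; ring
  obtain ⟨s, hs'⟩ := hunit _ hs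
  have hsf : s * ρ' f = x := by
    have h1 := congrArg ρ h
    simp only [map_add, map_mul, map_one] at h1
    rw [hs', hρ'']
    linear_combination (-e₀) * h1 + (t' * ρ (δ f) * ρ g) * he₀e₀ - e₀ * ρ (δ f) * htt' + he₁
  let ψ : R[T;T⁻¹] →+* Q := eval₂ ρ' s
  have hψ : ψ.comp (algebraMap (MvPolynomial PUnit.{1} k) R[T;T⁻¹]) = algebraMap _ Q := by
    refine MvPolynomial.ringHom_ext (fun a => ?_) (fun i => ?_)
    · have h1 : algebraMap (MvPolynomial PUnit.{1} k) R[T;T⁻¹] (MvPolynomial.C a) =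
          C (algebraMap k R a) := by
        rw [← MvPolynomial.algebraMap_eq, ← IsScalarTower.algebraMap_apply]; rfl
      simp only [RingHom.comp_apply, h1, ψ, eval₂_C]
      exact ρ'.commutes a
    · simp only [RingHom.comp_apply, hX, ψ, map_mul, eval₂_C, eval₂_T, zpow_one]
      exact hsf
  refine ⟨{ ψ with commutes' := fun a => RingHom.congr_fun hψ a }, ?_⟩
  ext p
  change Ideal.Quotient.mk I (ψ p) = φ p
  suffices (Ideal.Quotient.mk I).comp ψ = (φ : R[T;T⁻¹] →+* Q ⧸ I) from
    RingHom.congr_fun this p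
  refine IsLocalization.ringHom_ext (Submonoid.powers (Polynomial.X : Polynomial R)) ?_
  refine Polynomial.ringHom_ext (fun a => ?_) ?_
  · simp only [RingHom.comp_apply, algebraMap_eq_toLaurent, Polynomial.toLaurent_C, ψ, eval₂_C,
      RingHom.coe_coe, hρ'', map_sub, map_mul, hmke₀, hρ']
    ring
  · simp only [RingHom.comp_apply, algebraMap_eq_toLaurent, Polynomial.toLaurent_X, ψ, eval₂_T,
      RingHom.coe_coe, zpow_one, hs', hs]

/-- If `R` and the regular hypersurface `R ⧸ (f)` are smooth over `k` then the function `T f` on the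
product of `Spec R` with `𝔾ₘ` is smooth over `𝔸¹`, even though `f` alone need not be. -/
theorem smooth_laurentPolynomial_of_smooth_quotient {k R : Type} [CommRing k] [CommRing R]
    [Algebra k R] [Algebra.Smooth k R] {f : R} (hf : f ∈ nonZeroDivisors R)
    [Algebra.FormallySmooth k (R ⧸ Ideal.span {f})]
    [Algebra (MvPolynomial PUnit.{1} k) R[T;T⁻¹]]
    [IsScalarTower k (MvPolynomial PUnit.{1} k) R[T;T⁻¹]]
    (hX : algebraMap (MvPolynomial PUnit.{1} k) R[T;T⁻¹] (.X ⟨⟩) = T 1 * C f) :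
    Algebra.Smooth (MvPolynomial PUnit.{1} k) R[T;T⁻¹] where
  formallySmooth := by
    obtain ⟨δ, g, h⟩ := exists_derivation_of_formallySmooth_quotient (k := k) hf
    exact formallySmooth_laurentPolynomial_of_derivation δ h hX
  finitePresentation := by
    have : Algebra.FinitePresentation (Polynomial R) R[T;T⁻¹] :=
      IsLocalization.Away.finitePresentation Polynomial.X
    have : IsScalarTower R (Polynomial R) R[T;T⁻¹] :=
      .of_algebraMap_eq fun r => (Polynomial.toLaurent_C r).symm
    have : Algebra.FinitePresentation R R[T;T⁻¹] := .trans R (Polynomial R) _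
    have : Algebra.FinitePresentation k R[T;T⁻¹] := .trans k R _
    exact .of_restrict_scalars_finitePresentation k _ _

/-- A retract of a formally smooth algebra is formally smooth. -/
theorem RingHom.FormallySmooth.of_retract {A B C B' : Type*} [CommRing A] [CommRing B] [CommRing C]
    [CommRing B'] {f : A →+* B} {g : B →+* C} {h : C →+* B'} (hgf : (g.comp f).FormallySmooth)
    (hhg : Function.Bijective (h.comp g)) : f.FormallySmooth := by
  algebraize [f, g, g.comp f]
  rw [RingHom.FormallySmooth] at hgf ⊢
  let e := RingEquiv.ofBijective (h.comp g) hhg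
  let r : C →+* B := e.symm.toRingHom.comp h
  have hr (b : B) : r (algebraMap B C b) = b := e.symm_apply_apply b
  let r' : C →ₐ[A] B := { r with
    commutes' := fun a => by
      rw [IsScalarTower.algebraMap_apply A B C]; exact hr _ }
  refine Algebra.FormallySmooth.iff_comp_surjective.mpr fun Q _ _ I hI φ => ?_
  obtain ⟨ψ, hψ⟩ := Algebra.FormallySmooth.comp_surjective A C I hI (φ.comp r')
  refine ⟨ψ.comp (IsScalarTower.toAlgHom A B C), ?_⟩
  ext b
  have := AlgHom.congr_fun hψ (algebraMap B C b)
  simp only [AlgHom.comp_apply] at this ⊢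
  change _ = φ (r _) at this
  rw [hr] at this
  exact this

end Algebra

/-! ### Morphisms that are defined locally -/

/-- A morphism that locally factors through a monomorphism factors through it. -/
theorem exists_factorization_of_locally {X Y Z : Scheme.{0}} (m : X ⟶ Z) [Mono m] (f : Y ⟶ Z)
    (h : ∀ y : Y, ∃ W : Y.Opens, y ∈ W ∧ ∃ k : W.toScheme ⟶ X, k ≫ m = W.ι ≫ f) :
    ∃ k : Y ⟶ X, k ≫ m = f := by
  choose W hW k hk using h
  let 𝒰 : Y.OpenCover := Y.openCoverOfIsOpenCover W
    (.mk (eq_top_iff.mpr fun y _ => TopologicalSpace.Opens.mem_iSup.mpr ⟨y, hW y⟩))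
  have hk' (y : 𝒰.I₀) : (show 𝒰.X y ⟶ X from k y) ≫ m = 𝒰.f y ≫ f := hk y
  refine ⟨𝒰.glueMorphisms (fun y => show 𝒰.X y ⟶ X from k y) fun x y => ?_,
    𝒰.hom_ext _ _ fun y => ?_⟩
  · rw [← cancel_mono m, Category.assoc, Category.assoc, hk', hk', pullback.condition_assoc]
  · rw [𝒰.ι_glueMorphisms_assoc, hk']

/-- A morphism is determined by its restrictions to neighbourhoods of all points. -/
theorem hom_ext_of_locally {X Y : Scheme.{0}} {f g : Y ⟶ X}
    (h : ∀ y : Y, ∃ W : Y.Opens, y ∈ W ∧ W.ι ≫ f = W.ι ≫ g) : f = g := by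
  choose W hW h using h
  exact (Y.openCoverOfIsOpenCover W
    (.mk (eq_top_iff.mpr fun y _ => TopologicalSpace.Opens.mem_iSup.mpr ⟨y, hW y⟩))).hom_ext _ _ h

@[simp]
theorem coe_pullUnit {V' V : Scheme.{0}} (f : V' ⟶ V) (c : Γ(V, ⊤)ˣ) :
    (pullUnit f c : Γ(V', ⊤)) = f.appTop.hom c := rfl

theorem appTop_comp_apply {X Y Z : Scheme.{0}} (f : X ⟶ Y) (g : Y ⟶ Z) (s : Γ(Z, ⊤)) :
    (f ≫ g).appTop.hom s = f.appTop.hom (g.appTop.hom s) := by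
  rw [Scheme.Hom.comp_appTop, CommRingCat.hom_comp, RingHom.comp_apply]

theorem pullUnit_comp {V'' V' V : Scheme.{0}} (g : V'' ⟶ V') (f : V' ⟶ V) (c : Γ(V, ⊤)ˣ) :
    pullUnit (g ≫ f) c = pullUnit g (pullUnit f c) := by
  ext; simp only [coe_pullUnit, appTop_comp_apply]

/-! ### Torsors under the multiplicative group -/

namespace GmTorsor

variable {T : Scheme.{0}} (Q : GmTorsor T)

/-- The function `c` with `r = c • q`, for two points `q`, `r` of a torsor in the same fibre. -/
noncomputable def div {V : Scheme.{0}} (q r : V ⟶ Q.total) (h : q ≫ Q.proj = r ≫ Q.proj) :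
    Γ(V, ⊤)ˣ :=
  (Q.simply_transitive q r h).choose

variable {Q} {V V' : Scheme.{0}} {q r : V ⟶ Q.total}

@[simp]
theorem act_div (h : q ≫ Q.proj = r ≫ Q.proj) : Q.act (Q.div q r h) q = r :=
  (Q.simply_transitive q r h).choose_spec.1

theorem eq_of_act_eq {c d : Γ(V, ⊤)ˣ} (h : Q.act c q = Q.act d q) : c = d :=
  (Q.simply_transitive q (Q.act d q) (Q.act_proj d q).symm).unique h rfl

theorem pullUnit_div (f : V' ⟶ V) (h : q ≫ Q.proj = r ≫ Q.proj) :
    pullUnit f (Q.div q r h) = Q.div (f ≫ q) (f ≫ r) (by simp [h]) := by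
  apply eq_of_act_eq (q := f ≫ q)
  rw [← Q.comp_act, act_div, act_div]

theorem div_eq {c : Γ(V, ⊤)ˣ} (h : q ≫ Q.proj = r ≫ Q.proj) (hc : Q.act c q = r) :
    Q.div q r h = c :=
  eq_of_act_eq (by rw [act_div, hc])

/-- Every point of a torsor is locally a multiple of a section of the torsor. -/
theorem exists_local_lift (Q : GmTorsor T) (x : V ⟶ T) (z : V) :
    ∃ W : V.Opens, z ∈ W ∧ ∃ e : W.toScheme ⟶ Q.total, e ≫ Q.proj = W.ι ≫ x := by
  obtain ⟨W, hW, e, he⟩ := Q.local_section (x z)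
  refine ⟨x ⁻¹ᵁ W, hW, (x ∣_ W) ≫ e, ?_⟩
  rw [Category.assoc, he, morphismRestrict_ι]

end GmTorsor

/-- An equivariant morphism of torsors is cartesian. -/
theorem GmTorsor.isPullback_of_equivariant {S T : Scheme.{0}} (R : GmTorsor S) (Q : GmTorsor T)
    (b : S ⟶ T) (t : R.total ⟶ Q.total) (w : t ≫ Q.proj = R.proj ≫ b)
    (ht : ∀ {V : Scheme.{0}} (c : Γ(V, ⊤)ˣ) (q : V ⟶ R.total), R.act c q ≫ t = Q.act c (q ≫ t)) :
    IsPullback R.proj t b Q.proj := by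
  let m : R.total ⟶ pullback b Q.proj := pullback.lift R.proj t w.symm
  have hm₁ : m ≫ pullback.fst _ _ = R.proj := pullback.lift_fst _ _ _
  have hm₂ : m ≫ pullback.snd _ _ = t := pullback.lift_snd _ _ _
  -- The comparison with the fibre product is a monomorphism by simple transitivity and has sections
  -- locally, hence is an isomorphism.
  have : Mono m := by
    refine ⟨fun q r h => ?_⟩
    have hp : q ≫ R.proj = r ≫ R.proj := by rw [← hm₁, ← Category.assoc, h, Category.assoc]
    have ht' : q ≫ t = r ≫ t := by rw [← hm₂, ← Category.assoc, h, Category.assoc]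
    have h1 : R.div q r hp = 1 := by
      apply Q.eq_of_act_eq (q := q ≫ t)
      rw [← ht, act_div, Q.one_act, ht']
    rw [← act_div hp, h1, R.one_act]
  obtain ⟨k, hk⟩ := exists_factorization_of_locally m (𝟙 _) fun z => by
    obtain ⟨W, hW, e, he⟩ := R.exists_local_lift (pullback.fst b Q.proj) z
    have h : (e ≫ t) ≫ Q.proj = (W.ι ≫ pullback.snd b Q.proj) ≫ Q.proj := by
      simp only [Category.assoc, w, ← pullback.condition]
      rw [reassoc_of% he]
    refine ⟨W, hW, R.act (Q.div (e ≫ t) (W.ι ≫ pullback.snd b Q.proj) h) e, ?_⟩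
    rw [Category.comp_id]
    apply pullback.hom_ext
    · rw [Category.assoc, hm₁, R.act_proj, he]
    · rw [Category.assoc, hm₂, ht, act_div]
  have : IsIso m := by
    refine ⟨k, ?_, hk⟩
    rw [← cancel_mono m, Category.assoc, hk, Category.comp_id, Category.id_comp]
  exact .of_iso_pullback ⟨w.symm⟩ (asIso m) hm₁ hm₂

/-- The action of `𝔾ₘ` on the pullback of a torsor. -/
noncomputable def GmTorsor.pullbackAct {S T : Scheme.{0}} (Q : GmTorsor T) (b : S ⟶ T)
    {V : Scheme.{0}} (c : Γ(V, ⊤)ˣ) (q : V ⟶ pullback b Q.proj) : V ⟶ pullback b Q.proj :=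
  pullback.lift (q ≫ pullback.fst _ _) (Q.act c (q ≫ pullback.snd _ _))
    (by rw [Q.act_proj, Category.assoc, pullback.condition, Category.assoc])

section

variable {S T : Scheme.{0}} (Q : GmTorsor T) (b : S ⟶ T)
    {V : Scheme.{0}} (c : Γ(V, ⊤)ˣ) (q : V ⟶ pullback b Q.proj)

@[simp]
theorem GmTorsor.pullbackAct_fst :
    Q.pullbackAct b c q ≫ pullback.fst b Q.proj = q ≫ pullback.fst b Q.proj :=
  pullback.lift_fst _ _ _

@[simp]
theorem GmTorsor.pullbackAct_snd :
    Q.pullbackAct b c q ≫ pullback.snd b Q.proj = Q.act c (q ≫ pullback.snd b Q.proj) :=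
  pullback.lift_snd _ _ _

end

/-- The pullback of a torsor along a morphism. -/
noncomputable def GmTorsor.pullback {S T : Scheme.{0}} (Q : GmTorsor T) (b : S ⟶ T) :
    GmTorsor S where
  total := Limits.pullback b Q.proj
  proj := pullback.fst b Q.proj
  act c q := Q.pullbackAct b c q
  comp_act f c q := by
    apply pullback.hom_ext <;> simp [Q.comp_act]
  one_act q := by
    apply pullback.hom_ext <;> simp [Q.one_act]
  mul_act c d q := by
    apply pullback.hom_ext <;> simp [Q.mul_act]
  act_proj c q := Q.pullbackAct_fst b c q
  simply_transitive q r h := by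
    have h' : (q ≫ pullback.snd _ _) ≫ Q.proj = (r ≫ pullback.snd _ _) ≫ Q.proj := by
      simp only [Category.assoc, ← pullback.condition, reassoc_of% h]
    refine ⟨Q.div _ _ h', ?_, fun c hc => ?_⟩
    · apply pullback.hom_ext <;> simp [h]
    · refine (Q.div_eq h' ?_).symm
      rw [← hc, pullbackAct_snd]
  local_section s := by
    obtain ⟨W, hW, e, he⟩ := Q.exists_local_lift b s
    exact ⟨W, hW, pullback.lift W.ι e he.symm, pullback.lift_fst _ _ _⟩

/-- The pullback of a torsor with an equivariant map to `𝔸¹` along a morphism. -/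
noncomputable def GmTorsorWithMap.pullback {S T : Scheme.{0}} (Q : GmTorsorWithMap T) (b : S ⟶ T) :
    GmTorsorWithMap S where
  toGmTorsor := Q.toGmTorsor.pullback b
  fn := (pullback.snd b Q.proj).appTop.hom Q.fn
  act_fn {V} c (q : V ⟶ Limits.pullback b Q.proj) := by
    have : (Q.pullbackAct b c q).appTop.hom ((pullback.snd b Q.proj).appTop.hom Q.fn) =
        c * q.appTop.hom ((pullback.snd b Q.proj).appTop.hom Q.fn) := by
      rw [← appTop_comp_apply, Q.pullbackAct_snd, Q.act_fn, appTop_comp_apply]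
    exact this

namespace A1GmObj

/-- The pullback of an object of `[𝔸¹/𝔾ₘ]` along a morphism to its base. -/
noncomputable def pullback (B : A1GmObj) {S : SchC} (b : S ⟶ B.base) : A1GmObj where
  base := S
  tors := B.tors.pullback b.left

/-- The projection from the pullback. -/
noncomputable def pullbackHom (B : A1GmObj) {S : SchC} (b : S ⟶ B.base) :
    B.pullback b ⟶ B where
  base := b
  top := pullback.snd b.left B.tors.proj
  top_proj := pullback.condition.symm
  act_top _ _ := pullback.lift_snd _ _ _
  top_fn := rfl

end A1GmObj

/-! ### The trivial torsor over an affine scheme -/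

section Trivial

open scoped LaurentPolynomial
open LaurentPolynomial

/-- The product of `Spec R` with `𝔾ₘ`. -/
noncomputable abbrev specGm (R : CommRingCat.{0}) : Scheme.{0} := Spec (.of R[T;T⁻¹])

/-- The projection `Spec R × 𝔾ₘ ⟶ Spec R`. -/
noncomputable def specGmProj (R : CommRingCat.{0}) : specGm R ⟶ Spec R :=
  Spec.map (CommRingCat.ofHom C)

/-- The coordinate of `𝔾ₘ` as an invertible function on `Spec R × 𝔾ₘ`. -/
noncomputable def specGmCoord (R : CommRingCat.{0}) : Γ(specGm R, ⊤)ˣ :=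
  Units.map (Scheme.ΓSpecIso (.of R[T;T⁻¹])).inv.hom.toMonoidHom (isUnit_T 1).unit

variable {R : CommRingCat.{0}} {V : Scheme.{0}}

/-- The morphism to `Spec R × 𝔾ₘ` with given components. -/
noncomputable def specGmLift (x : V ⟶ Spec R) (c : Γ(V, ⊤)ˣ) : V ⟶ specGm R :=
  V.toSpecΓ ≫ Spec.map (CommRingCat.ofHom
    (eval₂ ((Scheme.ΓSpecIso R).inv ≫ x.appTop).hom c))

@[simp]
theorem specGmLift_proj (x : V ⟶ Spec R) (c : Γ(V, ⊤)ˣ) : specGmLift x c ≫ specGmProj R = x := by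
  rw [specGmLift, specGmProj, Category.assoc, ← Spec.map_comp, ← CommRingCat.ofHom_comp]
  have : (eval₂ ((Scheme.ΓSpecIso R).inv ≫ x.appTop).hom c).comp C =
      ((Scheme.ΓSpecIso R).inv ≫ x.appTop).hom := RingHom.ext fun r => eval₂_C _ _ _
  rw [this, CommRingCat.ofHom_hom, Spec.map_comp, ← Scheme.toSpecΓ_naturality_assoc]
  simp

@[simp]
theorem pullUnit_specGmLift (x : V ⟶ Spec R) (c : Γ(V, ⊤)ˣ) :
    pullUnit (specGmLift x c) (specGmCoord R) = c := by
  ext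
  have h : (specGmLift x c).appTop = (Scheme.ΓSpecIso (.of R[T;T⁻¹])).hom ≫
      CommRingCat.ofHom (eval₂ ((Scheme.ΓSpecIso R).inv ≫ x.appTop).hom c) := by
    simp [specGmLift]
  rw [coe_pullUnit, h]
  simp [specGmCoord]

/-- `Spec R × 𝔾ₘ` is a product: its points are determined by their components. -/
theorem specGm_hom_ext {f g : V ⟶ specGm R} (h₁ : f ≫ specGmProj R = g ≫ specGmProj R)
    (h₂ : pullUnit f (specGmCoord R) = pullUnit g (specGmCoord R)) : f = g := by
  apply (ΓSpec.adjunction.homEquiv _ _).symm.injective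
  apply Quiver.Hom.unop_inj
  rw [Adjunction.homEquiv_symm_apply, Adjunction.homEquiv_symm_apply]
  dsimp
  ext : 1
  refine IsLocalization.ringHom_ext (Submonoid.powers (Polynomial.X : Polynomial R)) ?_
  refine Polynomial.ringHom_ext (fun a => ?_) ?_
  · have := congrArg (fun f => f.appTop.hom ((Scheme.ΓSpecIso R).inv.hom a)) h₁
    simp only [appTop_comp_apply] at this
    have h (r : R) : (specGmProj R).appTop.hom ((Scheme.ΓSpecIso R).inv.hom r) =
        (Scheme.ΓSpecIso (.of R[T;T⁻¹])).inv.hom (C r) := by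
      have := Scheme.ΓSpecIso_inv_naturality (CommRingCat.ofHom (C (R := R)))
      exact congrArg (fun f => f.hom r) this.symm
    rw [h] at this
    simpa using this
  · have := congrArg Units.val h₂
    simpa [specGmCoord] using this

/-- The trivial torsor over an affine scheme. -/
noncomputable def trivialTorsor (R : CommRingCat.{0}) : GmTorsor (Spec R) where
  total := specGm R
  proj := specGmProj R
  act c q := specGmLift (q ≫ specGmProj R) (c * pullUnit q (specGmCoord R))
  comp_act f c q := by
    apply specGm_hom_ext <;> simp [pullUnit_comp]
  one_act q := by
    apply specGm_hom_ext <;> simp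
  mul_act c d q := by
    apply specGm_hom_ext <;> simp [mul_assoc]
  act_proj c q := specGmLift_proj _ _
  simply_transitive q r h := by
    refine ⟨pullUnit r (specGmCoord R) * (pullUnit q (specGmCoord R))⁻¹, ?_, fun c hc => ?_⟩
    · apply specGm_hom_ext <;> simp [h]
    · have := congrArg (fun r => pullUnit r (specGmCoord R)) hc
      simp only [pullUnit_specGmLift] at this
      rw [← this, mul_inv_cancel_right]
  local_section t := ⟨⊤, trivial, specGmLift (Scheme.Opens.ι _) 1, specGmLift_proj _ _⟩

/-- The object of `[𝔸¹/𝔾ₘ]` that consists of the trivial line bundle and its zero section. -/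
noncomputable def zeroSectionObj (S : CommRingCat.{0}) (s : Spec S ⟶ Spec (.of ℂ)) : A1GmObj where
  base := Over.mk s
  tors :=
    { toGmTorsor := trivialTorsor S
      fn := 0
      act_fn := fun c q => by simp }

end Trivial

/-! ### Gluing along the pullback of an open cover -/

/-- Two morphisms from `Y` agree if they agree on the pullback of an open cover along `y : Y ⟶ S`.
-/
theorem hom_ext_of_cover {S Y Z : Scheme.{0}} (𝒰 : S.OpenCover) (y : Y ⟶ S) {f g : Y ⟶ Z}
    (h : ∀ (i : 𝒰.I₀) {V : Scheme.{0}} (r : V ⟶ Y) (a : V ⟶ 𝒰.X i), r ≫ y = a ≫ 𝒰.f i →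
      r ≫ f = r ≫ g) : f = g :=
  Scheme.Cover.hom_ext (𝒰.pullback₁ y) _ _ fun i =>
    h i (pullback.fst y (𝒰.f i)) (pullback.snd y (𝒰.f i)) pullback.condition

theorem exists_glue {Y Z : Scheme.{0}} (𝒱 : Y.OpenCover) (k : ∀ i, 𝒱.X i ⟶ Z)
    (hk : ∀ {i j : 𝒱.I₀} {V : Scheme.{0}} (a : V ⟶ 𝒱.X i) (a' : V ⟶ 𝒱.X j),
      a ≫ 𝒱.f i = a' ≫ 𝒱.f j → a ≫ k i = a' ≫ k j) :
    ∃ m : Y ⟶ Z, ∀ i, 𝒱.f i ≫ m = k i :=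
  ⟨𝒱.glueMorphisms k fun _ _ => hk _ _ pullback.condition, fun _ => 𝒱.ι_glueMorphisms _ _ _⟩

/-- Morphisms on the pullback of an open cover along `y : Y ⟶ S` glue if they agree on points of `Y`
that lie in two members of the cover. -/
theorem exists_glue_of_cover {S Y Z : Scheme.{0}} (𝒰 : S.OpenCover) (y : Y ⟶ S)
    (k : ∀ i, pullback y (𝒰.f i) ⟶ Z)
    (hk : ∀ {i j : 𝒰.I₀} {V : Scheme.{0}} (r : V ⟶ Y) (a : V ⟶ 𝒰.X i) (a' : V ⟶ 𝒰.X j)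
      (h : r ≫ y = a ≫ 𝒰.f i) (h' : r ≫ y = a' ≫ 𝒰.f j),
      pullback.lift r a h ≫ k i = pullback.lift r a' h' ≫ k j) :
    ∃ m : Y ⟶ Z, ∀ {i : 𝒰.I₀} {V : Scheme.{0}} (r : V ⟶ Y) (a : V ⟶ 𝒰.X i)
      (h : r ≫ y = a ≫ 𝒰.f i), r ≫ m = pullback.lift r a h ≫ k i := by
  have h1 (i : 𝒰.I₀) {V : Scheme.{0}} (r : V ⟶ pullback y (𝒰.f i)) (p : V ⟶ Y) (q : V ⟶ 𝒰.X i)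
      (h : p ≫ y = q ≫ 𝒰.f i) (hp : p = r ≫ pullback.fst _ _) (hq : q = r ≫ pullback.snd _ _) :
      pullback.lift p q h = r := by
    apply pullback.hom_ext
    · rw [pullback.lift_fst, hp]
    · rw [pullback.lift_snd, hq]
  obtain ⟨m, hm⟩ := exists_glue (𝒰.pullback₁ y) k
    fun {i j V} (a : V ⟶ pullback y (𝒰.f i)) (a' : V ⟶ pullback y (𝒰.f j))
      (h : a ≫ pullback.fst _ _ = a' ≫ pullback.fst _ _) => by
    have h2 : (a ≫ pullback.fst _ _) ≫ y = (a' ≫ pullback.snd _ _) ≫ 𝒰.f j := by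
      rw [h, Category.assoc, Category.assoc, pullback.condition]
    have h3 := hk (a ≫ pullback.fst _ _) (a ≫ pullback.snd _ _) (a' ≫ pullback.snd _ _)
      (by rw [Category.assoc, Category.assoc, pullback.condition]) h2
    rwa [h1 i a _ _ _ rfl rfl, h1 j a' _ _ _ h rfl] at h3
  refine ⟨m, fun {i V} r a h => ?_⟩
  have hm' : pullback.fst y (𝒰.f i) ≫ m = k i := hm i
  rw [← hm', pullback.lift_fst_assoc]

/-! ### Isomorphisms between torsors -/

/-- The function of an object of `[𝔸¹/𝔾ₘ]` as a morphism from the torsor to `𝔸¹` over `ℂ`. -/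
noncomputable def A1GmObj.fnMap (A : A1GmObj) :
    A.tors.total ⟶ 𝔸(PUnit.{1}; Spec (.of ℂ)) :=
  AffineSpace.homOfVector (A.tors.proj ≫ A.base.hom) fun _ => A.tors.fn

theorem A1GmObj.comp_fnMap (A : A1GmObj) {V : Scheme.{0}} (p : V ⟶ A.tors.total) :
    p ≫ A.fnMap =
      AffineSpace.homOfVector (p ≫ A.tors.proj ≫ A.base.hom) fun _ => p.appTop.hom A.tors.fn :=
  AffineSpace.comp_homOfVector _ _ _

theorem A1GmObj.comp_fnMap_eq_iff {A B : A1GmObj} {V : Scheme.{0}} {p : V ⟶ A.tors.total}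
    {q : V ⟶ B.tors.total} : p ≫ A.fnMap = q ≫ B.fnMap ↔
      p ≫ A.tors.proj ≫ A.base.hom = q ≫ B.tors.proj ≫ B.base.hom ∧
        p.appTop.hom A.tors.fn = q.appTop.hom B.tors.fn := by
  rw [A.comp_fnMap, B.comp_fnMap]
  refine ⟨fun h => ⟨?_, ?_⟩, fun h => ?_⟩
  · have := congrArg (fun f => f ≫ 𝔸(PUnit.{1}; Spec (.of ℂ)) ↘ Spec (.of ℂ)) h
    simpa only [AffineSpace.homOfVector_over] using this
  · have := congrArg (fun f => f.appTop (AffineSpace.coord _ PUnit.unit)) h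
    simpa only [AffineSpace.homOfVector_appTop_coord] using this
  · rw [h.1, h.2]

theorem A1GmObj.act_fnMap_eq {A B : A1GmObj} {V : Scheme.{0}} {p : V ⟶ A.tors.total}
    {q : V ⟶ B.tors.total} (c : Γ(V, ⊤)ˣ) (h : p ≫ A.fnMap = q ≫ B.fnMap) :
    A.tors.act c p ≫ A.fnMap = B.tors.act c q ≫ B.fnMap := by
  rw [comp_fnMap_eq_iff] at h ⊢
  rw [← Category.assoc, ← Category.assoc, A.tors.act_proj, B.tors.act_proj, Category.assoc,
    Category.assoc, A.tors.act_fn, B.tors.act_fn, h.1, h.2]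
  exact ⟨rfl, rfl⟩

theorem A1GmHom.top_fnMap {A B : A1GmObj} (f : A ⟶ B) : f.top ≫ B.fnMap = A.fnMap := by
  have : f.top ≫ B.fnMap = 𝟙 _ ≫ A.fnMap := by
    rw [A1GmObj.comp_fnMap_eq_iff]
    refine ⟨?_, by simpa using f.top_fn⟩
    rw [Category.id_comp, ← Category.assoc, f.top_proj, Category.assoc, Over.w]
  simpa using this

/-- A point with values in `S` of the scheme of isomorphisms between the torsors of `A` and `B`: a
point `base` of the base of `B` together with an equivariant morphism `map` over `𝔸¹` to the
torsor of `A` from the pullback of the torsor of `B`.  The point of the base of `A` below it is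
determined by `map`. -/
structure IsomPoint (A B : A1GmObj) (S : Scheme.{0}) where
  base : S ⟶ B.base.left
  map : pullback base B.tors.proj ⟶ A.tors.total
  act_map : ∀ {V : Scheme.{0}} (c : Γ(V, ⊤)ˣ) (q : V ⟶ pullback base B.tors.proj),
    B.tors.pullbackAct base c q ≫ map = A.tors.act c (q ≫ map)
  map_fnMap : map ≫ A.fnMap = pullback.snd _ _ ≫ B.fnMap

namespace IsomPoint

variable {A B : A1GmObj} {S S' : Scheme.{0}}

/-- The value of an isomorphism of torsors at a point `q` over `x`. -/
noncomputable def eval (φ : IsomPoint A B S) {V : Scheme.{0}} (x : V ⟶ S)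
    (q : V ⟶ B.tors.total) (h : x ≫ φ.base = q ≫ B.tors.proj) : V ⟶ A.tors.total :=
  pullback.lift x q h ≫ φ.map

theorem comp_eval (φ : IsomPoint A B S) {V V' : Scheme.{0}} (g : V' ⟶ V) (x : V ⟶ S)
    (q : V ⟶ B.tors.total) (h : x ≫ φ.base = q ≫ B.tors.proj) :
    g ≫ φ.eval x q h = φ.eval (g ≫ x) (g ≫ q) (by simp [h]) := by
  rw [eval, eval, ← Category.assoc]
  congr 1
  apply pullback.hom_ext
  · rw [Category.assoc, pullback.lift_fst, pullback.lift_fst]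
  · rw [Category.assoc, pullback.lift_snd, pullback.lift_snd]

theorem eval_act (φ : IsomPoint A B S) {V : Scheme.{0}} (x : V ⟶ S) (c : Γ(V, ⊤)ˣ)
    (q : V ⟶ B.tors.total) (h : x ≫ φ.base = q ≫ B.tors.proj) :
    φ.eval x (B.tors.act c q) (h.trans (B.tors.act_proj c q).symm) =
      A.tors.act c (φ.eval x q h) := by
  rw [eval, eval, ← φ.act_map]
  congr 1
  apply pullback.hom_ext
  · rw [B.tors.pullbackAct_fst, pullback.lift_fst, pullback.lift_fst]
  · rw [B.tors.pullbackAct_snd, pullback.lift_snd, pullback.lift_snd]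

theorem eval_fnMap (φ : IsomPoint A B S) {V : Scheme.{0}} (x : V ⟶ S)
    (q : V ⟶ B.tors.total) (h : x ≫ φ.base = q ≫ B.tors.proj) :
    φ.eval x q h ≫ A.fnMap = q ≫ B.fnMap := by
  rw [eval, Category.assoc, φ.map_fnMap, pullback.lift_snd_assoc]

theorem map_eq_eval (φ : IsomPoint A B S) :
    φ.map = φ.eval (pullback.fst _ _) (pullback.snd _ _) pullback.condition := by
  rw [eval]
  have : pullback.lift (pullback.fst _ _) (pullback.snd _ _) pullback.condition =
    𝟙 (pullback φ.base B.tors.proj) := by apply pullback.hom_ext <;> simp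
  rw [this, Category.id_comp]

theorem ext {φ ψ : IsomPoint A B S} (hb : φ.base = ψ.base)
    (h : ∀ {V : Scheme.{0}} (x : V ⟶ S) (q : V ⟶ B.tors.total)
      (hφ : x ≫ φ.base = q ≫ B.tors.proj) (hψ : x ≫ ψ.base = q ≫ B.tors.proj),
      φ.eval x q hφ = ψ.eval x q hψ) : φ = ψ := by
  have h' := h (pullback.fst φ.base B.tors.proj) (pullback.snd _ _) pullback.condition
    (by rw [← hb, pullback.condition])
  obtain ⟨b, m, hm₁, hm₂⟩ := φ
  obtain ⟨b', m', hm₁', hm₂'⟩ := ψ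
  obtain rfl : b = b' := hb
  rw [← map_eq_eval, ← map_eq_eval] at h'
  obtain rfl : m = m' := h'
  rfl

theorem eval_congr {φ ψ : IsomPoint A B S} (h : φ = ψ) {V : Scheme.{0}} {x x' : V ⟶ S}
    {q q' : V ⟶ B.tors.total} (hx : x = x') (hq : q = q') (hφ : x ≫ φ.base = q ≫ B.tors.proj)
    (hψ : x' ≫ ψ.base = q' ≫ B.tors.proj) : φ.eval x q hφ = ψ.eval x' q' hψ := by
  subst h hx hq
  rfl

/-- The restriction of a point along a morphism. -/
noncomputable def restrict (φ : IsomPoint A B S) (f : S' ⟶ S) : IsomPoint A B S' where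
  base := f ≫ φ.base
  map := φ.eval (pullback.fst _ _ ≫ f) (pullback.snd _ _)
    (by rw [Category.assoc, pullback.condition])
  act_map c q := by
    rw [comp_eval, comp_eval, ← eval_act]
    congr 1
    · rw [← Category.assoc, B.tors.pullbackAct_fst, Category.assoc]
    · rw [B.tors.pullbackAct_snd]
  map_fnMap := eval_fnMap _ _ _ _

@[simp]
theorem restrict_base (φ : IsomPoint A B S) (f : S' ⟶ S) :
    (φ.restrict f).base = f ≫ φ.base := rfl

theorem eval_restrict (φ : IsomPoint A B S) (f : S' ⟶ S) {V : Scheme.{0}} (x : V ⟶ S')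
    (q : V ⟶ B.tors.total) (h : x ≫ (φ.restrict f).base = q ≫ B.tors.proj) :
    (φ.restrict f).eval x q h = φ.eval (x ≫ f) q (by rw [Category.assoc, ← h]; rfl) := by
  have h₀ : x ≫ f ≫ φ.base = q ≫ B.tors.proj := h
  change pullback.lift x q h₀ ≫ φ.eval (pullback.fst _ _ ≫ f) (pullback.snd _ _) _ = _
  rw [comp_eval]
  exact eval_congr rfl (pullback.lift_fst_assoc _ _ _ _) (pullback.lift_snd _ _ _) _ _

@[simp]
theorem restrict_id (φ : IsomPoint A B S) : φ.restrict (𝟙 S) = φ := by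
  apply ext
  · simp
  · intro V x q h h'
    rw [eval_restrict]
    exact eval_congr rfl (Category.comp_id x) rfl _ _

theorem restrict_comp {S'' : Scheme.{0}} (φ : IsomPoint A B S) (g : S'' ⟶ S') (f : S' ⟶ S) :
    φ.restrict (g ≫ f) = (φ.restrict f).restrict g := by
  apply ext
  · simp
  · intro V x q h h'
    rw [eval_restrict, eval_restrict, eval_restrict]
    exact eval_congr rfl (Category.assoc x g f).symm rfl _ _

theorem ext_of_cover {φ ψ : IsomPoint A B S} (𝒰 : S.OpenCover)
    (h : ∀ i, φ.restrict (𝒰.f i) = ψ.restrict (𝒰.f i)) : φ = ψ := by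
  apply ext
  · exact 𝒰.hom_ext _ _ fun i => congrArg base (h i)
  · intro V x q hφ hψ
    refine hom_ext_of_cover 𝒰 x fun i W r a h' => ?_
    rw [comp_eval, comp_eval]
    have h1 : (a ≫ 𝒰.f i) ≫ φ.base = (r ≫ q) ≫ B.tors.proj := by
      rw [← h', Category.assoc, hφ, Category.assoc]
    have h2 : (a ≫ 𝒰.f i) ≫ ψ.base = (r ≫ q) ≫ B.tors.proj := by
      rw [← h', Category.assoc, hψ, Category.assoc]
    rw [eval_congr rfl h' rfl _ h1, eval_congr (φ := ψ) rfl h' rfl _ h2,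
      ← eval_restrict _ _ _ _ (by rw [restrict_base, ← h1, Category.assoc]),
      ← eval_restrict _ _ _ _ (by rw [restrict_base, ← h2, Category.assoc])]
    exact eval_congr (h i) rfl rfl _ _

/-- Isomorphisms of torsors glue. -/
theorem exists_glue (𝒰 : S.OpenCover) (x : ∀ i, IsomPoint A B (𝒰.X i))
    (hx : ∀ {i j : 𝒰.I₀} {Z : Scheme.{0}} (a : Z ⟶ 𝒰.X i) (a' : Z ⟶ 𝒰.X j),
      a ≫ 𝒰.f i = a' ≫ 𝒰.f j → (x i).restrict a = (x j).restrict a') :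
    ∃ φ : IsomPoint A B S, ∀ i, φ.restrict (𝒰.f i) = x i := by
  let b : S ⟶ B.base.left := 𝒰.glueMorphisms (fun i => (x i).base) fun i j =>
    congrArg base (hx _ _ pullback.condition)
  have hb (i : 𝒰.I₀) : 𝒰.f i ≫ b = (x i).base := 𝒰.ι_glueMorphisms _ _ _
  have heq {i j : 𝒰.I₀} {Z : Scheme.{0}} (a : Z ⟶ 𝒰.X i) (a' : Z ⟶ 𝒰.X j)
      (h : a ≫ 𝒰.f i = a' ≫ 𝒰.f j) (q q' : Z ⟶ B.tors.total) (hq' : q = q') (hq hq'') :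
      (x i).eval a q hq = (x j).eval a' q' hq'' := by
    have h1 := eval_congr (hx a a' h) (x := 𝟙 Z) rfl hq' (by simpa using hq) (by simpa using hq'')
    rw [eval_restrict, eval_restrict] at h1
    simpa using h1
  have hb' (i : 𝒰.I₀) {V : Scheme.{0}} (a : V ⟶ 𝒰.X i) (r : V ⟶ pullback b B.tors.proj)
      (h : r ≫ pullback.fst b B.tors.proj = a ≫ 𝒰.f i) :
      a ≫ (x i).base = (r ≫ pullback.snd _ _) ≫ B.tors.proj := by
    rw [← hb, ← Category.assoc, ← h, Category.assoc, pullback.condition, Category.assoc]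
  obtain ⟨m, hm⟩ := exists_glue_of_cover 𝒰 (pullback.fst b B.tors.proj)
    (fun i => (x i).eval (pullback.snd _ _) (pullback.fst _ _ ≫ pullback.snd _ _)
      (hb' i _ _ pullback.condition)) (fun {i j V} r a a' h h' => by
    rw [comp_eval, comp_eval]
    refine heq _ _ ?_ _ _ ?_ _ _
    · rw [pullback.lift_snd, pullback.lift_snd, ← h, ← h']
    · rw [pullback.lift_fst_assoc, pullback.lift_fst_assoc])
  replace hm {i : 𝒰.I₀} {V : Scheme.{0}} (a : V ⟶ 𝒰.X i) (r : V ⟶ pullback b B.tors.proj)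
      (h : r ≫ pullback.fst _ _ = a ≫ 𝒰.f i) :
      r ≫ m = (x i).eval a (r ≫ pullback.snd _ _) (hb' i a r h) := by
    rw [hm r a h, comp_eval]
    exact eval_congr rfl (pullback.lift_snd _ _ _) (pullback.lift_fst_assoc _ _ _ _) _ _
  refine ⟨⟨b, m, fun {V} c q => ?_, ?_⟩, fun i => ?_⟩
  · refine hom_ext_of_cover 𝒰 (q ≫ pullback.fst _ _) fun i W r a h => ?_
    rw [← Category.assoc] at h
    rw [A.tors.comp_act, ← Category.assoc, ← Category.assoc,
      hm a _ (by rw [Category.assoc, B.tors.pullbackAct_fst, ← Category.assoc, h]),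
      hm a _ h, ← eval_act]
    apply eval_congr rfl rfl
    rw [Category.assoc, B.tors.pullbackAct_snd, B.tors.comp_act, Category.assoc]
  · refine hom_ext_of_cover 𝒰 (pullback.fst _ _) fun i W r a h => ?_
    rw [← Category.assoc, hm a _ h, eval_fnMap, Category.assoc]
  · apply ext
    · exact hb i
    · intro V y q h h'
      rw [eval_restrict, eval, hm y _ (by rw [pullback.lift_fst])]
      exact eval_congr rfl rfl (pullback.lift_snd _ _ _) _ _

end IsomPoint

/-! ### Descent along torsors -/

theorem exists_glue_of_opens {S Z : Scheme.{0}} (W : S → S.Opens) (hW : ∀ s, s ∈ W s)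
    (k : ∀ s, (W s).toScheme ⟶ Z)
    (hk : ∀ {i j : S} {V : Scheme.{0}} (a : V ⟶ W i) (a' : V ⟶ W j),
      a ≫ (W i).ι = a' ≫ (W j).ι → a ≫ k i = a' ≫ k j) :
    ∃ m : S ⟶ Z, ∀ s, (W s).ι ≫ m = k s :=
  exists_glue (S.openCoverOfIsOpenCover W
    (.mk (eq_top_iff.mpr fun y _ => TopologicalSpace.Opens.mem_iSup.mpr ⟨y, hW y⟩))) k hk

namespace GmTorsor

variable {S Y : Scheme.{0}} (R : GmTorsor S)

/-- The projection of a torsor is an epimorphism, because it has sections locally. -/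
theorem proj_cancel {f g : S ⟶ Y} (h : R.proj ≫ f = R.proj ≫ g) : f = g :=
  hom_ext_of_locally fun s => by
    obtain ⟨W, hW, e, he⟩ := R.local_section s
    exact ⟨W, hW, by rw [← he, Category.assoc, h, Category.assoc]⟩

/-- An invariant morphism on a torsor descends to the base. -/
theorem exists_descent (g : R.total ⟶ Y)
    (hg : ∀ {V : Scheme.{0}} (c : Γ(V, ⊤)ˣ) (q : V ⟶ R.total), R.act c q ≫ g = q ≫ g) :
    ∃ f : S ⟶ Y, R.proj ≫ f = g := by
  choose W hW e he using R.local_section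
  have key {V : Scheme.{0}} (q r : V ⟶ R.total) (h : q ≫ R.proj = r ≫ R.proj) :
      q ≫ g = r ≫ g := by
    rw [← act_div h, hg]
  obtain ⟨f, hf⟩ := exists_glue_of_opens W hW (fun s => e s ≫ g) fun {i j V} a a' h => by
    rw [← Category.assoc, ← Category.assoc]
    apply key
    rw [Category.assoc, he, h, Category.assoc, he]
  refine ⟨f, hom_ext_of_locally fun z => ⟨R.proj ⁻¹ᵁ W (R.proj z), hW _, ?_⟩⟩
  rw [← morphismRestrict_ι_assoc, hf, ← Category.assoc]
  apply key
  rw [Category.assoc, he, morphismRestrict_ι]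

end GmTorsor

/-! ### Representability of the functor of isomorphisms -/

namespace IsomPoint

variable {A B : A1GmObj} {S : Scheme.{0}}

/-- Over a section `e` of the torsor of `B`, a point is determined by its value at `e`. -/
theorem ext_of_section {φ ψ : IsomPoint A B S} (hb : φ.base = ψ.base) (e : S ⟶ B.tors.total)
    (hφ : 𝟙 S ≫ φ.base = e ≫ B.tors.proj) (hψ : 𝟙 S ≫ ψ.base = e ≫ B.tors.proj)
    (h : φ.eval (𝟙 S) e hφ = ψ.eval (𝟙 S) e hψ) : φ = ψ := by
  apply ext hb
  intro V x q h₁ h₂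
  have h₃ : (x ≫ e) ≫ B.tors.proj = q ≫ B.tors.proj := by
    rw [Category.assoc, ← hφ, Category.id_comp, h₁]
  have key (χ : IsomPoint A B S) (h₁ : x ≫ χ.base = q ≫ B.tors.proj)
      (h₂ : 𝟙 S ≫ χ.base = e ≫ B.tors.proj) : χ.eval x q h₁ =
        A.tors.act (B.tors.div _ _ h₃) (x ≫ χ.eval (𝟙 S) e h₂) := by
    rw [comp_eval, ← eval_act]
    exact eval_congr rfl (Category.comp_id x).symm (GmTorsor.act_div h₃).symm _ _
  rw [key φ h₁ hφ, key ψ h₂ hψ, h]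

/-- If `e` is a section of the torsor of `B` then an isomorphism of torsors is the same as a
section `p` of the torsor of `A` with the same value in `𝔸¹`. -/
noncomputable def ofSection (e : S ⟶ B.tors.total) (p : S ⟶ A.tors.total)
    (hp : p ≫ A.fnMap = e ≫ B.fnMap) : IsomPoint A B S where
  base := e ≫ B.tors.proj
  map := A.tors.act (B.tors.div (pullback.fst _ _ ≫ e) (pullback.snd _ _)
    (by rw [Category.assoc, pullback.condition])) (pullback.fst _ _ ≫ p)
  act_map c q := by
    rw [A.tors.comp_act, A.tors.comp_act, ← A.tors.mul_act, GmTorsor.pullUnit_div,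
      GmTorsor.pullUnit_div]
    have h {Z : Scheme.{0}} (r : S ⟶ Z) : B.tors.pullbackAct (e ≫ B.tors.proj) c q ≫
        pullback.fst _ _ ≫ r = q ≫ pullback.fst _ _ ≫ r := by
      rw [← Category.assoc, B.tors.pullbackAct_fst, Category.assoc]
    refine congrArg₂ A.tors.act (GmTorsor.div_eq _ ?_) (h p)
    rw [h, B.tors.pullbackAct_snd, B.tors.mul_act, GmTorsor.act_div]
  map_fnMap := by
    rw [A1GmObj.act_fnMap_eq (B := B) (q := pullback.fst _ _ ≫ e) _
      (by rw [Category.assoc, hp, Category.assoc]), GmTorsor.act_div]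

theorem eval_ofSection (e : S ⟶ B.tors.total) (p : S ⟶ A.tors.total)
    (hp : p ≫ A.fnMap = e ≫ B.fnMap) {V : Scheme.{0}} (x : V ⟶ S)
    (h : x ≫ (ofSection e p hp).base = (x ≫ e) ≫ B.tors.proj) :
    (ofSection e p hp).eval x (x ≫ e) h = x ≫ p := by
  have h' : x ≫ e ≫ B.tors.proj = (x ≫ e) ≫ B.tors.proj := h
  change pullback.lift x (x ≫ e) h' ≫ A.tors.act _ _ = _
  rw [A.tors.comp_act, pullback.lift_fst_assoc, GmTorsor.pullUnit_div,
    GmTorsor.div_eq (c := 1), A.tors.one_act]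
  rw [B.tors.one_act, pullback.lift_fst_assoc, pullback.lift_snd]

/-- The part over `W` of the scheme of isomorphisms, for a section `e` over `W` of the torsor
of `B`. -/
noncomputable abbrev chart (A B : A1GmObj) {W : B.base.left.Opens}
    (e : W.toScheme ⟶ B.tors.total) : Scheme.{0} :=
  pullback A.fnMap (e ≫ B.fnMap)

/-- The isomorphism of torsors over a chart. -/
noncomputable def chartPoint (A B : A1GmObj) {W : B.base.left.Opens}
    (e : W.toScheme ⟶ B.tors.total) : IsomPoint A B (chart A B e) :=
  ofSection (pullback.snd _ _ ≫ e) (pullback.fst _ _) (by rw [pullback.condition, Category.assoc])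

variable {W : B.base.left.Opens} {e : W.toScheme ⟶ B.tors.total}

theorem eval_chartPoint (x : S ⟶ chart A B e) {q : S ⟶ B.tors.total}
    (hq : q = (x ≫ pullback.snd _ _) ≫ e)
    (h : x ≫ (chartPoint A B e).base = q ≫ B.tors.proj) :
    (chartPoint A B e).eval x q h = x ≫ pullback.fst _ _ := by
  rw [Category.assoc] at hq
  subst hq
  exact eval_ofSection _ _ _ x h

variable (he : e ≫ B.tors.proj = W.ι)

include he

theorem chartPoint_base :
    (chartPoint A B e).base = pullback.snd A.fnMap (e ≫ B.fnMap) ≫ W.ι := by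
  rw [← he, ← Category.assoc]
  rfl

theorem chart_hom_ext {f g : S ⟶ chart A B e}
    (h : f ≫ pullback.snd _ _ = g ≫ pullback.snd _ _)
    (h' : (chartPoint A B e).restrict f = (chartPoint A B e).restrict g) : f = g := by
  have h₁ (f : S ⟶ chart A B e) : f ≫ (chartPoint A B e).base =
      ((f ≫ pullback.snd _ _) ≫ e) ≫ B.tors.proj := by
    rw [chartPoint_base he, Category.assoc, Category.assoc, he]
  have h₂ (f : S ⟶ chart A B e) {q : S ⟶ B.tors.total} (hq : (f ≫ pullback.snd _ _) ≫ e = q) :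
      𝟙 S ≫ ((chartPoint A B e).restrict f).base = q ≫ B.tors.proj := by
    rw [restrict_base, Category.id_comp, h₁, hq]
  apply pullback.hom_ext
  · rw [← eval_chartPoint f rfl (h₁ f), ← eval_chartPoint g rfl (h₁ g)]
    have h₃ := eval_congr h' rfl rfl (h₂ f rfl) (h₂ g (congrArg (· ≫ e) h.symm))
    rw [eval_restrict, eval_restrict] at h₃
    refine (eval_congr rfl (Category.id_comp f).symm rfl _ _).trans
      (h₃.trans (eval_congr rfl (Category.id_comp g) ?_ _ _))
    rw [h]
  · exact h

/-- A point whose base lies in `W` is a point of the chart over `W`. -/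
theorem exists_chart_lift (φ : IsomPoint A B S) (v : S ⟶ W.toScheme) (hv : φ.base = v ≫ W.ι) :
    ∃ f : S ⟶ chart A B e, f ≫ pullback.snd _ _ = v ∧ (chartPoint A B e).restrict f = φ := by
  have h₁ : 𝟙 S ≫ φ.base = (v ≫ e) ≫ B.tors.proj := by
    rw [hv, Category.assoc, he, Category.id_comp]
  let f : S ⟶ chart A B e := pullback.lift (φ.eval (𝟙 S) (v ≫ e) h₁) v
    (by rw [φ.eval_fnMap, Category.assoc])
  have hf : f ≫ pullback.snd _ _ = v := pullback.lift_snd _ _ _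
  have hb : ((chartPoint A B e).restrict f).base = φ.base := by
    rw [restrict_base, chartPoint_base he, hv, ← Category.assoc, hf]
  refine ⟨f, hf, ext_of_section hb (v ≫ e) (by rw [hb, h₁]) h₁ ?_⟩
  rw [eval_restrict, eval_chartPoint (𝟙 S ≫ f) (by rw [Category.id_comp, hf]), Category.id_comp]
  exact pullback.lift_fst _ _ _

end IsomPoint

/-- The functor of points of the scheme of isomorphisms between the torsors of `A` and `B`. -/
noncomputable def isomFunctor (A B : A1GmObj) : Scheme.{0}ᵒᵖ ⥤ Type where
  obj S := IsomPoint A B S.unop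
  map f := ↾fun φ => φ.restrict f.unop
  map_id _ := ConcreteCategory.hom_ext _ _ fun φ => φ.restrict_id
  map_comp f g := ConcreteCategory.hom_ext _ _ fun φ => φ.restrict_comp g.unop f.unop

theorem isomFunctor_isSheaf (A B : A1GmObj) :
    Presieve.IsSheaf Scheme.zariskiTopology (isomFunctor A B) := by
  rw [Precoverage.isSheaf_toGrothendieck_iff_of_isStableUnderBaseChange]
  rintro Y S hS x hx
  obtain ⟨(𝒰 : Scheme.OpenCover Y), rfl⟩ := Scheme.exists_cover_of_mem_pretopology hS
  obtain ⟨φ, hφ⟩ := IsomPoint.exists_glue 𝒰 (fun i => x (𝒰.f i) (.mk i))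
    fun {i j Z} a a' h => hx _ _ _ _ h
  refine ⟨φ, ?_, fun ψ hψ => ?_⟩
  · rintro Z f ⟨i⟩
    exact hφ i
  · exact IsomPoint.ext_of_cover 𝒰 fun i => (hψ (𝒰.f i) (.mk i)).trans (hφ i).symm

/-- The projection from the scheme of isomorphisms to the base of `B`. -/
noncomputable def isomFunctorBase (A B : A1GmObj) : isomFunctor A B ⟶ yoneda.obj B.base.left where
  app S := ↾fun φ : IsomPoint A B S.unop => φ.base

/-- The chart over `W` is the part of the functor that lies over the open subscheme `W` of the base
of `B`. -/
theorem isPullback_chart {A B : A1GmObj} {W : B.base.left.Opens} {e : W.toScheme ⟶ B.tors.total}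
    (he : e ≫ B.tors.proj = W.ι) :
    IsPullback (yonedaEquiv.symm (show (isomFunctor A B).obj (op (IsomPoint.chart A B e)) from
      IsomPoint.chartPoint A B e)) (yoneda.map (pullback.snd A.fnMap (e ≫ B.fnMap)))
      (isomFunctorBase A B) (yoneda.map W.ι) := by
  refine .of_forall_isPullback_app fun S => ?_
  rw [Types.isPullback_iff]
  refine ⟨?_, ?_, ?_⟩
  · ext (f : S.unop ⟶ IsomPoint.chart A B e)
    change f ≫ (IsomPoint.chartPoint A B e).base = (f ≫ pullback.snd _ _) ≫ W.ι
    rw [IsomPoint.chartPoint_base he, Category.assoc]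
  · rintro f g ⟨h, h'⟩
    exact IsomPoint.chart_hom_ext he h' h
  · intro φ v h
    obtain ⟨f, hf, hf'⟩ := IsomPoint.exists_chart_lift he φ v h
    exact ⟨f, hf', hf⟩

/-- The charts over the opens where the torsor of `B` has a section are an open cover of the functor
by schemes. -/
theorem isomFunctor_isRepresentable (A B : A1GmObj) : (isomFunctor A B).IsRepresentable := by
  choose W hW e he using B.tors.local_section
  let F : Sheaf Scheme.zariskiTopology Type :=
    ⟨isomFunctor A B, (isSheaf_iff_isSheaf_of_type _ _).mpr (isomFunctor_isSheaf A B)⟩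
  let f (t : B.base.left) : yoneda.obj (IsomPoint.chart A B (e t)) ⟶ F.1 :=
    yonedaEquiv.symm (show (isomFunctor A B).obj (op (IsomPoint.chart A B (e t))) from
      IsomPoint.chartPoint A B (e t))
  have hf (t : B.base.left) : IsOpenImmersion.presheaf (f t) :=
    (MorphismProperty.relative_isStableUnderBaseChange _).of_isPullback
      (isPullback_chart (he t)).flip (MorphismProperty.relative_map inferInstance)
  have : Presheaf.IsLocallySurjective Scheme.zariskiTopology (Sigma.desc f) := by
    refine ⟨fun {S} (φ : IsomPoint A B S) => ?_⟩
    let 𝒰 : B.base.left.OpenCover := B.base.left.openCoverOfIsOpenCover W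
      (.mk (eq_top_iff.mpr fun y _ => TopologicalSpace.Opens.mem_iSup.mpr ⟨y, hW y⟩))
    refine GrothendieckTopology.superset_covering _ ?_
      (Scheme.Cover.mem_grothendieckTopology (𝒰.pullback₁ φ.base))
    rw [Sieve.generate_le_iff]
    rintro Z g ⟨t⟩
    obtain ⟨k, -, hk⟩ := IsomPoint.exists_chart_lift (he t)
      (φ.restrict (pullback.fst φ.base (𝒰.f t))) (pullback.snd φ.base (𝒰.f t)) pullback.condition
    have h : Sigma.ι (fun t => yoneda.obj (IsomPoint.chart A B (e t))) t ≫ Sigma.desc f = f t :=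
      Sigma.ι_desc _ _
    let k' : (yoneda.obj (IsomPoint.chart A B (e t))).obj (op (pullback φ.base (𝒰.f t))) := k
    exact ⟨(Sigma.ι (fun t => yoneda.obj (IsomPoint.chart A B (e t))) t).app _ k',
      (ConcreteCategory.congr_hom (congr_app h _) k').trans hk⟩
  exact Scheme.LocalRepresentability.isRepresentable (F := F) (f := f) hf

/-! ### Products in `[𝔸¹/𝔾ₘ]` -/

/-- A lift of an equivariant morphism to the pullback of a torsor is equivariant. -/
theorem GmTorsor.act_lift {S T Z : Scheme.{0}} (R : GmTorsor Z) (Q : GmTorsor T) (b : S ⟶ T)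
    (f : Z ⟶ S) (t : R.total ⟶ Q.total) (w : (R.proj ≫ f) ≫ b = t ≫ Q.proj)
    (ht : ∀ {V : Scheme.{0}} (c : Γ(V, ⊤)ˣ) (q : V ⟶ R.total), R.act c q ≫ t = Q.act c (q ≫ t))
    {V : Scheme.{0}} (c : Γ(V, ⊤)ˣ) (q : V ⟶ R.total) :
    R.act c q ≫ pullback.lift (R.proj ≫ f) t w =
      Q.pullbackAct b c (q ≫ pullback.lift (R.proj ≫ f) t w) := by
  apply pullback.hom_ext
  · rw [Q.pullbackAct_fst, Category.assoc, Category.assoc, pullback.lift_fst,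
      ← Category.assoc, R.act_proj, Category.assoc]
  · rw [Q.pullbackAct_snd, Category.assoc, Category.assoc, pullback.lift_snd, ht]

/-- A morphism is determined by the morphism of torsors, as the projection of a torsor is an
epimorphism. -/
theorem A1GmHom.ext_top {A B : A1GmObj} {f g : A ⟶ B} (h : f.top = g.top) : f = g := by
  refine A1GmHom.ext (Over.OverMorphism.ext (A.tors.proj_cancel ?_)) h
  rw [← f.top_proj, ← g.top_proj, h]

namespace IsomPoint

variable {A B C : A1GmObj} {S : Scheme.{0}}

/-- The object of `[𝔸¹/𝔾ₘ]` over `S` that is pulled back from `B`. -/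
noncomputable def obj (φ : IsomPoint A B S) : A1GmObj :=
  B.pullback (S := Over.mk (φ.base ≫ B.base.hom)) (Over.homMk φ.base rfl)

/-- The projection to `B`. -/
noncomputable def snd (φ : IsomPoint A B S) : φ.obj ⟶ B :=
  B.pullbackHom (S := Over.mk (φ.base ≫ B.base.hom)) (Over.homMk φ.base rfl)

/-- The morphism from the pulled back torsor to the torsor of `A` descends to the bases, because it
is equivariant. -/
theorem exists_hom (φ : IsomPoint A B S) : ∃ a : φ.obj ⟶ A, a.top = φ.map := by
  have hφ : φ.map ≫ A.tors.proj ≫ A.base.hom = pullback.snd _ _ ≫ B.tors.proj ≫ B.base.hom ∧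
      φ.map.appTop.hom A.tors.fn = (pullback.snd φ.base B.tors.proj).appTop.hom B.tors.fn :=
    A1GmObj.comp_fnMap_eq_iff.mp φ.map_fnMap
  obtain ⟨f, hf⟩ : ∃ f : S ⟶ A.base.left,
      pullback.fst φ.base B.tors.proj ≫ f = φ.map ≫ A.tors.proj :=
    (B.tors.toGmTorsor.pullback φ.base).exists_descent (φ.map ≫ A.tors.proj)
      fun {V} c (q : V ⟶ pullback φ.base B.tors.proj) => by
        have : B.tors.pullbackAct φ.base c q ≫ φ.map ≫ A.tors.proj =
            q ≫ φ.map ≫ A.tors.proj := by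
          rw [← Category.assoc, φ.act_map, A.tors.act_proj, Category.assoc]
        exact this
  have hf' : f ≫ A.base.hom = φ.base ≫ B.base.hom :=
    (B.tors.toGmTorsor.pullback φ.base).proj_cancel <| by
      have : pullback.fst φ.base B.tors.proj ≫ f ≫ A.base.hom =
          pullback.fst φ.base B.tors.proj ≫ φ.base ≫ B.base.hom := by
        rw [reassoc_of% hf, hφ.1, pullback.condition_assoc]
      exact this
  exact ⟨{ base := Over.homMk f hf'
           top := φ.map
           top_proj := hf.symm
           act_top := φ.act_map
           top_fn := hφ.2 }, rfl⟩

/-- A morphism of `[𝔸¹/𝔾ₘ]` is cartesian on the torsors. -/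
theorem exists_lift_of_hom (h : C ⟶ B) {V : Scheme.{0}} (x : V ⟶ C.base.left)
    (q : V ⟶ B.tors.total) (w : x ≫ h.base.left = q ≫ B.tors.proj) :
    ∃ r : V ⟶ C.tors.total, r ≫ C.tors.proj = x ∧ r ≫ h.top = q := by
  have hP := C.tors.isPullback_of_equivariant B.tors.toGmTorsor h.base.left h.top h.top_proj
    h.act_top
  exact ⟨hP.lift x q w, hP.lift_fst _ _ _, hP.lift_snd _ _ _⟩

/-- Over the base of an object `C` with a morphism to `B`, a point is determined by its value on the
torsor of `C`. -/
theorem ext_of_hom (h : C ⟶ B) {φ ψ : IsomPoint A B C.base.left} (hφ : φ.base = h.base.left)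
    (hψ : ψ.base = h.base.left)
    (H : φ.eval C.tors.proj h.top (by rw [hφ, h.top_proj]) =
      ψ.eval C.tors.proj h.top (by rw [hψ, h.top_proj])) : φ = ψ := by
  apply ext (hφ.trans hψ.symm)
  intro V x q h₁ h₂
  obtain ⟨r, rfl, rfl⟩ := exists_lift_of_hom h x q (by rw [← hφ, h₁])
  rw [← comp_eval _ _ _ _ (by rw [hφ, h.top_proj]), ← comp_eval _ _ _ _ (by rw [hψ, h.top_proj]), H]

/-- Morphisms from `C` to `A` and `B` are an isomorphism over the base of `C` between the pullbacks
of the torsors of `A` and `B`, both of which are identified with the torsor of `C`. -/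
theorem exists_of_span (g : C ⟶ A) (h : C ⟶ B) : ∃ φ : IsomPoint A B C.base.left,
    φ.base = h.base.left ∧ ∀ w, φ.eval C.tors.proj h.top w = g.top := by
  have hP := C.tors.isPullback_of_equivariant B.tors.toGmTorsor h.base.left h.top h.top_proj
    h.act_top
  have key {V : Scheme.{0}} (c : Γ(V, ⊤)ˣ) (q : V ⟶ pullback h.base.left B.tors.proj) :
      B.tors.pullbackAct h.base.left c q ≫ hP.isoPullback.inv =
        C.tors.act c (q ≫ hP.isoPullback.inv) := by
    apply hP.hom_ext
    · rw [Category.assoc, hP.isoPullback_inv_fst, B.tors.pullbackAct_fst, C.tors.act_proj,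
        Category.assoc, hP.isoPullback_inv_fst]
    · rw [Category.assoc, hP.isoPullback_inv_snd, B.tors.pullbackAct_snd, h.act_top,
        Category.assoc, hP.isoPullback_inv_snd]
  refine ⟨⟨h.base.left, hP.isoPullback.inv ≫ g.top, fun c q => ?_, ?_⟩, rfl, fun w => ?_⟩
  · rw [← Category.assoc, key, g.act_top, Category.assoc]
  · rw [Category.assoc, g.top_fnMap, ← h.top_fnMap, ← Category.assoc, hP.isoPullback_inv_snd]
  · change pullback.lift C.tors.proj h.top h.top_proj.symm ≫ hP.isoPullback.inv ≫ g.top = g.top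
    have : pullback.lift C.tors.proj h.top h.top_proj.symm ≫ hP.isoPullback.inv = 𝟙 _ := by
      apply hP.hom_ext
      · rw [Category.assoc, hP.isoPullback_inv_fst, pullback.lift_fst, Category.id_comp]
      · rw [Category.assoc, hP.isoPullback_inv_snd, pullback.lift_snd, Category.id_comp]
    rw [reassoc_of% this]

theorem eval_restrict_of_lift (φ : IsomPoint A B S) {Z V : Scheme.{0}} (f : Z ⟶ S) (x : V ⟶ Z)
    (t : V ⟶ pullback φ.base B.tors.proj) (ht : t ≫ pullback.fst _ _ = x ≫ f) (w) :
    (φ.restrict f).eval x (t ≫ pullback.snd _ _) w = t ≫ φ.map := by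
  rw [eval_restrict, map_eq_eval, comp_eval]
  exact eval_congr rfl ht.symm rfl _ _

/-- The object over a scheme that represents the isomorphisms of torsors is a product. -/
theorem exists_isLimit (φ : IsomPoint A B S)
    (hφ : ∀ {Z : Scheme.{0}} (ψ : IsomPoint A B Z), ∃! f : Z ⟶ S, φ.restrict f = ψ)
    (a : φ.obj ⟶ A) (ha : a.top = φ.map) : Nonempty (IsLimit (BinaryFan.mk a φ.snd)) := by
  have key {C : A1GmObj} (m : C ⟶ φ.obj) (h : C ⟶ B) (hm : m ≫ φ.snd = h) w :
      (φ.restrict m.base.left).eval C.tors.proj h.top w = (m ≫ a).top := by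
    subst hm
    refine (eval_restrict_of_lift φ _ _ _ m.top_proj _).trans ?_
    rw [← ha]
    rfl
  have hb {C : A1GmObj} (m : C ⟶ φ.obj) (h : C ⟶ B) (hm : m ≫ φ.snd = h) :
      (φ.restrict m.base.left).base = h.base.left := by
    subst hm
    rfl
  have hl {C : A1GmObj} (g : C ⟶ A) (h : C ⟶ B) : ∃ m : C ⟶ φ.obj, m ≫ a = g ∧ m ≫ φ.snd = h := by
    obtain ⟨ψ, hψ, hψ'⟩ := exists_of_span g h
    obtain ⟨f, hf, -⟩ := hφ ψ
    have hf' : f ≫ φ.base = h.base.left := by rw [← hψ, ← hf]; rfl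
    have hw : (C.tors.proj ≫ f) ≫ φ.base = h.top ≫ B.tors.proj := by
      rw [Category.assoc, hf', h.top_proj]
    let m : C ⟶ φ.obj :=
      { base := Over.homMk f (by
          have : f ≫ φ.base ≫ B.base.hom = C.base.hom := by
            rw [← Category.assoc, hf', Over.w]
          exact this)
        top := pullback.lift (C.tors.proj ≫ f) h.top hw
        top_proj := pullback.lift_fst _ _ _
        act_top := C.tors.act_lift B.tors.toGmTorsor _ _ _ hw h.act_top
        top_fn := by
          change (pullback.lift (C.tors.proj ≫ f) h.top hw).appTop.hom
            ((pullback.snd φ.base B.tors.proj).appTop.hom B.tors.fn) = C.tors.fn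
          rw [← appTop_comp_apply, pullback.lift_snd, h.top_fn] }
    have hm : m ≫ φ.snd = h := A1GmHom.ext_top (pullback.lift_snd _ _ _)
    refine ⟨m, A1GmHom.ext_top ?_, hm⟩
    rw [← key m h hm (by rw [hb m h hm, h.top_proj]), ← hψ' (by rw [hψ, h.top_proj])]
    exact eval_congr hf rfl rfl _ _
  choose l hl₁ hl₂ using @hl
  refine ⟨BinaryFan.IsLimit.mk _ (fun g h => l g h) (fun g h => hl₁ g h) (fun g h => hl₂ g h) ?_⟩
  rintro C g h m hm₁ hm₂
  change m ≫ a = g at hm₁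
  change m ≫ φ.snd = h at hm₂
  have h₁ : m.base.left = (l g h).base.left := by
    refine (hφ (φ.restrict m.base.left)).unique rfl (Eq.symm ?_)
    refine ext_of_hom h (hb m h hm₂) (hb _ h (hl₂ g h)) ?_
    rw [key m h hm₂, key _ h (hl₂ g h), hm₁, hl₁]
  refine A1GmHom.ext_top (pullback.hom_ext ?_ ?_)
  · exact m.top_proj.trans ((congrArg (C.tors.proj ≫ ·) h₁).trans (l g h).top_proj.symm)
  · exact (congrArg A1GmHom.top hm₂).trans (congrArg A1GmHom.top (hl₂ g h)).symm

end IsomPoint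

/-- The universal isomorphism of torsors. -/
theorem exists_universal_isomPoint (A B : A1GmObj) : ∃ (S : Scheme.{0}) (φ : IsomPoint A B S),
    ∀ {Z : Scheme.{0}} (ψ : IsomPoint A B Z), ∃! f : Z ⟶ S, φ.restrict f = ψ := by
  have := isomFunctor_isRepresentable A B
  let R := (isomFunctor A B).representableBy
  have hR {Z : Scheme.{0}} (f : Z ⟶ _) :
      R.homEquiv f = (R.homEquiv (𝟙 _) : IsomPoint A B _).restrict f :=
    R.homEquiv_eq f
  refine ⟨_, R.homEquiv (𝟙 _), fun {Z} ψ => ⟨R.homEquiv.symm ψ, ?_, fun f hf => ?_⟩⟩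
  · exact (hR _).symm.trans (R.homEquiv.apply_symm_apply ψ)
  · exact R.homEquiv.injective ((hR f).trans (hf.trans (R.homEquiv.apply_symm_apply ψ).symm))

/-- The scheme of isomorphisms is smooth over the base of `B`: over an open where the torsor of `B`
has a section it is a base change of the function `A.fnMap`. -/
theorem IsomPoint.smooth_base {A B : A1GmObj} [Smooth A.fnMap] {S : Scheme.{0}}
    (φ : IsomPoint A B S)
    (hφ : ∀ {Z : Scheme.{0}} (ψ : IsomPoint A B Z), ∃! f : Z ⟶ S, φ.restrict f = ψ) :
    Smooth φ.base := by
  choose W hW e he using B.tors.local_section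
  let 𝒰 : B.base.left.OpenCover := B.base.left.openCoverOfIsOpenCover W
    (.mk (eq_top_iff.mpr fun y _ => TopologicalSpace.Opens.mem_iSup.mpr ⟨y, hW y⟩))
  have : IsZariskiLocalAtTarget @Smooth.{0} :=
    HasRingHomProperty.instIsZariskiLocalAtTarget @Smooth.{0}
  refine (IsZariskiLocalAtTarget.iff_of_openCover (P := @Smooth) 𝒰).mpr fun t => ?_
  obtain ⟨k, hk, -⟩ := hφ (chartPoint A B (e t))
  have hk' : k ≫ φ.base = pullback.snd A.fnMap (e t ≫ B.fnMap) ≫ (W t).ι := by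
    rw [← chartPoint_base (he t), ← hk]; rfl
  have hl {Z : Scheme.{0}} (z : Z ⟶ S) (w : Z ⟶ (W t).toScheme) (h : z ≫ φ.base = w ≫ (W t).ι) :
      ∃ l : Z ⟶ chart A B (e t), l ≫ k = z ∧ l ≫ pullback.snd _ _ = w := by
    obtain ⟨l, hl, hl'⟩ := exists_chart_lift (he t) (φ.restrict z) w h
    refine ⟨l, (hφ (φ.restrict z)).unique ?_ rfl, hl⟩
    rw [restrict_comp, hk, hl']
  choose l hl₁ hl₂ using @hl
  -- The universal property identifies the part over `W t` with the chart.
  have hP : IsPullback k (pullback.snd A.fnMap (e t ≫ B.fnMap)) φ.base (W t).ι := by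
    refine ⟨⟨hk'⟩, ⟨PullbackCone.IsLimit.mk _ (fun s => l s.fst s.snd s.condition)
      (fun s => hl₁ _ _ _) (fun s => hl₂ _ _ _) fun s m hm hm' => ?_⟩⟩
    refine chart_hom_ext (he t) (hm'.trans (hl₂ _ _ s.condition).symm) ?_
    rw [← hk, ← restrict_comp, ← restrict_comp, hm, hl₁]
  have hs : Smooth (pullback.snd φ.base (W t).ι) := by
    rw [← hP.isoPullback_inv_snd]
    infer_instance
  exact hs

/-- If the function on the torsor of `A` is smooth over `ℂ`, as a morphism to `𝔸¹`, then the
morphism to `[𝔸¹/𝔾ₘ]` given by `A` is representable and smooth. -/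
theorem exists_isLimit_binaryFan (A B : A1GmObj) [Smooth A.fnMap] :
    ∃ (w : A1GmObj) (a : w ⟶ A) (b : w ⟶ B), Nonempty (IsLimit (BinaryFan.mk a b)) ∧
      Smooth b.base.left := by
  obtain ⟨S, φ, hφ⟩ := exists_universal_isomPoint A B
  obtain ⟨a, ha⟩ := φ.exists_hom
  exact ⟨φ.obj, a, φ.snd, φ.exists_isLimit hφ a ha, φ.smooth_base hφ⟩

/-! ### The zero scheme of a function on a torsor -/

/-- A function pulls back to zero if it does so on every affine open. -/
theorem AlgebraicGeometry.Scheme.Hom.appTop_eq_zero_iff {Y P : Scheme.{0}} (g : Y ⟶ P)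
    (s : Γ(P, ⊤)) :
    g.appTop.hom s = 0 ↔
      ∀ W : P.affineOpens, (g.app W.1).hom ((P.presheaf.map (homOfLE le_top).op).hom s) = 0 := by
  have key (W : P.affineOpens) : (g.app W.1).hom ((P.presheaf.map (homOfLE le_top).op).hom s) =
      (Y.presheaf.map (homOfLE le_top).op).hom (g.appTop.hom s) :=
    ConcreteCategory.congr_hom (g.naturality (homOfLE (le_top : W.1 ≤ ⊤)).op) s
  simp only [key]
  refine ⟨fun h W => by rw [h, map_zero], fun h => ?_⟩
  refine TopCat.Presheaf.IsSheaf.section_ext Y.IsSheaf fun y _ => ?_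
  obtain ⟨W, hW, hy, -⟩ := exists_isAffineOpen_mem_and_subset (X := P) (x := g y) (U := ⊤) trivial
  exact ⟨g ⁻¹ᵁ W, le_top, hy, (h ⟨W, hW⟩).trans (map_zero _).symm⟩

/-- The universal property of a closed subscheme. -/
theorem factors_iff_le_ker {Y U : Scheme.{0}} (I : U.IdealSheafData) (g : Y ⟶ U) :
    (∃ k : Y ⟶ I.subscheme, k ≫ I.subschemeι = g) ↔ I ≤ g.ker := by
  refine ⟨?_, fun h => ?_⟩
  · rintro ⟨k, rfl⟩
    exact I.ker_subschemeι.ge.trans (Scheme.Hom.le_ker_comp _ _)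
  · exact ⟨IsClosedImmersion.lift I.subschemeι g (I.ker_subschemeι.le.trans h),
      IsClosedImmersion.lift_fac _ _ _⟩

/-- The section of the line bundle given by `A` has the zero scheme `I`: on the torsor, the pullback
of the ideal sheaf `I` is generated by the function of `A`. -/
def A1GmObj.HasZeroScheme (A : A1GmObj) (I : A.base.left.IdealSheafData) : Prop :=
  ∀ W : A.tors.total.affineOpens, (I.comap A.tors.proj).ideal W =
    Ideal.span {(A.tors.total.presheaf.map (homOfLE (le_top : W.1 ≤ ⊤)).op).hom A.tors.fn}

/-- The points of the torsor that lie over the zero scheme are the zeros of the function. -/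
theorem A1GmObj.HasZeroScheme.factors_iff {A : A1GmObj} {I : A.base.left.IdealSheafData}
    (hs : A.HasZeroScheme I) {Y : Scheme.{0}} (g : Y ⟶ A.tors.total) :
    (∃ k : Y ⟶ I.subscheme, k ≫ I.subschemeι = g ≫ A.tors.proj) ↔
      g.appTop.hom A.tors.fn = 0 := by
  rw [factors_iff_le_ker, Scheme.Hom.ker_comp, Scheme.IdealSheafData.le_map_iff_comap_le,
    Scheme.Hom.appTop_eq_zero_iff, Scheme.Hom.ker, Scheme.IdealSheafData.le_ofIdeals_iff]
  refine forall_congr' fun W => ?_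
  rw [hs, Ideal.span_singleton_le_iff_mem, RingHom.mem_ker]

/-- The ideal sheaf of an effective Cartier divisor contains a regular section on arbitrarily small
affine neighbourhoods. -/
theorem IsEffectiveCartierIdeal.exists_affine {U : Scheme.{0}} {I : U.IdealSheafData}
    (hI : IsEffectiveCartierIdeal I) (z : U) (W : U.Opens) (hW : z ∈ W) :
    ∃ V : U.affineOpens, z ∈ V.1 ∧ V.1 ≤ W ∧
      ∃ f ∈ nonZeroDivisors Γ(U, V.1), f ∈ I.ideal V := by
  obtain ⟨V, hz, f, hf, hIf⟩ := hI z
  obtain ⟨r, hr, hr'⟩ := V.2.exists_basicOpen_le ⟨z, hW⟩ hz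
  have := V.2.isLocalization_basicOpen r
  refine ⟨U.affineBasicOpen r, hr', hr,
    (U.presheaf.map (homOfLE (U.basicOpen_le r)).op).hom f, ?_, ?_⟩
  · exact IsLocalization.map_nonZeroDivisors_le (.powers r) Γ(U, U.basicOpen r) ⟨f, hf, rfl⟩
  · rw [← I.map_ideal_basicOpen]
    exact Ideal.mem_map_of_mem _ (by rw [hIf]; exact Ideal.mem_span_singleton_self f)

/-! ### Smoothness of the function of a torsor -/

section

open scoped LaurentPolynomial
open LaurentPolynomial

theorem AlgebraicGeometry.AffineSpace.homOfVector_specMap {R S : CommRingCat.{0}} (φ : S ⟶ R)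
    (r : R) :
    AffineSpace.homOfVector (n := PUnit.{1}) (Spec.map φ) (fun _ => (Scheme.ΓSpecIso R).inv.hom r) =
      Spec.map (CommRingCat.ofHom (MvPolynomial.eval₂Hom φ.hom fun _ => r)) ≫
        (AffineSpace.SpecIso PUnit.{1} S).inv := by
  apply AffineSpace.hom_ext
  · rw [AffineSpace.homOfVector_over, Category.assoc, AffineSpace.SpecIso_inv_over,
      ← Spec.map_comp]
    congr 1
    ext x
    simp
  · intro i
    rw [AffineSpace.homOfVector_appTop_coord, Scheme.Hom.comp_appTop, CommRingCat.comp_apply,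
      AffineSpace.SpecIso_inv_appTop_coord]
    have h := ConcreteCategory.congr_hom (Scheme.ΓSpecIso_inv_naturality
      (CommRingCat.ofHom (MvPolynomial.eval₂Hom φ.hom fun _ : PUnit.{1} => (r : R)))) (.X i)
    exact (congrArg (Scheme.ΓSpecIso R).inv.hom
      (MvPolynomial.eval₂Hom_X' φ.hom (fun _ : PUnit.{1} => (r : R)) i).symm).trans h

/-- The function `T f` on `Spec R × 𝔾ₘ` is smooth if `R` and the hypersurface `f = 0` are smooth
over the base and `f` is regular. -/
theorem smooth_homOfVector_of_smooth_quotient {R k : CommRingCat.{0}} (φ : k ⟶ R)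
    (hφ : φ.hom.Smooth) (f : R) (hf : f ∈ nonZeroDivisors R)
    (hf' : ((Ideal.Quotient.mk (Ideal.span {f})).comp φ.hom).Smooth) :
    Smooth (AffineSpace.homOfVector (n := PUnit.{1}) (specGmProj R ≫ Spec.map φ)
      fun _ => (Scheme.ΓSpecIso (.of R[T;T⁻¹])).inv.hom (T 1 * C f)) := by
  rw [specGmProj, ← Spec.map_comp, AffineSpace.homOfVector_specMap]
  let ψ := MvPolynomial.eval₂Hom (φ ≫ CommRingCat.ofHom (C (R := R))).hom
    fun _ : PUnit.{1} => (T 1 * C f : R[T;T⁻¹])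
  have hψ : ψ.Smooth := by
    algebraize [φ.hom]
    have : Algebra.Smooth k (R ⧸ Ideal.span {f}) := RingHom.smooth_algebraMap.mp hf'
    let := ψ.toAlgebra
    have : IsScalarTower k (MvPolynomial PUnit.{1} k) R[T;T⁻¹] := .of_algebraMap_eq fun x =>
      (MvPolynomial.eval₂Hom_C (φ ≫ CommRingCat.ofHom (C (R := R))).hom
        (fun _ : PUnit.{1} => (T 1 * C f : R[T;T⁻¹])) x).symm
    exact smooth_laurentPolynomial_of_smooth_quotient (k := k) hf
      (MvPolynomial.eval₂Hom_X' _ _ _)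
  have : Smooth (Spec.map (CommRingCat.ofHom ψ)) :=
    (HasRingHomProperty.Spec_iff (P := @Smooth)).mpr hψ
  infer_instance

/-- A morphism to `Spec R` that pulls `f` back to zero factors through `Spec (R ⧸ (f))`. -/
theorem exists_lift_spec_quotient {R : CommRingCat.{0}} (f : R) {Z : Scheme.{0}} (b : Z ⟶ Spec R)
    (hb : b.appTop.hom ((Scheme.ΓSpecIso R).inv.hom f) = 0) :
    ∃ l : Z ⟶ Spec (.of (R ⧸ Ideal.span {f})),
      l ≫ Spec.map (CommRingCat.ofHom (Ideal.Quotient.mk (Ideal.span {f}))) = b := by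
  let β : R →+* Γ(Z, ⊤) := ((Scheme.ΓSpecIso R).inv ≫ b.appTop).hom
  let β' : R ⧸ Ideal.span {f} →+* Γ(Z, ⊤) := Ideal.Quotient.lift _ β fun a ha =>
    (Ideal.span_singleton_le_iff_mem (RingHom.ker β)).mpr hb ha
  refine ⟨Z.toSpecΓ ≫ Spec.map (CommRingCat.ofHom β'), ?_⟩
  rw [Category.assoc, ← Spec.map_comp, ← CommRingCat.ofHom_comp]
  have : β'.comp (Ideal.Quotient.mk _) = β := Ideal.Quotient.lift_comp_mk _ _ _
  rw [this, CommRingCat.ofHom_hom, Spec.map_comp, ← Scheme.toSpecΓ_naturality_assoc]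
  simp

theorem spec_quotient_appTop {R : CommRingCat.{0}} (f a : R) :
    (Spec.map (CommRingCat.ofHom (Ideal.Quotient.mk (Ideal.span {f})))).appTop.hom
      ((Scheme.ΓSpecIso R).inv.hom a) =
        (Scheme.ΓSpecIso (.of (R ⧸ Ideal.span {f}))).inv.hom (Ideal.Quotient.mk _ a) :=
  (ConcreteCategory.congr_hom (Scheme.ΓSpecIso_inv_naturality
    (CommRingCat.ofHom (Ideal.Quotient.mk (Ideal.span {f})))) a).symm

/-- A section of `I` over `V` is a multiple of `f` if the closed subscheme `f = 0` of `V` is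
contained in that of `I`. -/
theorem AlgebraicGeometry.IsAffineOpen.mem_span_singleton_of_le_ker {U : Scheme.{0}}
    {I : U.IdealSheafData} (V : U.affineOpens) (f : Γ(U, V.1)) {a : Γ(U, V.1)} (ha : a ∈ I.ideal V)
    (h : I ≤ (Spec.map (CommRingCat.ofHom (Ideal.Quotient.mk (Ideal.span {f}))) ≫
      V.2.fromSpec).ker) : a ∈ Ideal.span {f} := by
  have h₁ := Scheme.Hom.ideal_ker_le _ _ (h V ha)
  rw [RingHom.mem_ker, Scheme.Hom.comp_app, V.2.fromSpec_app_self, Category.assoc,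
    Scheme.Hom.naturality] at h₁
  rw [← Ideal.Quotient.eq_zero_iff_mem]
  apply (Scheme.ΓSpecIso
    (.of (Γ(U, V.1) ⧸ Ideal.span {f}))).symm.commRingCatIsoToRingEquiv.injective
  rw [map_zero]
  refine (spec_quotient_appTop f a).symm.trans ?_
  rw [← Category.assoc] at h₁
  have hinj := (ConcreteCategory.bijective_of_isIso
    ((Spec (.of (Γ(U, V.1) ⧸ Ideal.span {f}))).presheaf.map
      ((TopologicalSpace.Opens.map (Spec.map (CommRingCat.ofHom
        (Ideal.Quotient.mk (Ideal.span {f})))).base).map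
          (eqToHom V.2.fromSpec_preimage_self).op.unop).op)).1
  exact hinj (h₁.trans (map_zero _).symm)

/-- Locally on the base, the torsor is `Spec R × 𝔾ₘ`, and the function on it is `T f` with a local
equation `f` of the divisor. -/
theorem exists_smooth_chart (A : A1GmObj) {I : A.base.left.IdealSheafData}
    (hI : IsEffectiveCartierIdeal I) (hs : A.HasZeroScheme I)
    [Smooth A.base.hom] [Smooth (I.subschemeι ≫ A.base.hom)] (z : A.base.left) :
    ∃ (R : CommRingCat.{0}) (j : Spec R ⟶ A.base.left) (t : specGm R ⟶ A.tors.total),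
      IsOpenImmersion j ∧ z ∈ Set.range j ∧ IsPullback t (specGmProj R) A.tors.proj j ∧
        Smooth (t ≫ A.fnMap) := by
  obtain ⟨W, hzW, e₀, he₀⟩ := A.tors.local_section z
  obtain ⟨V, hzV, hVW, h, hh, hhI⟩ := hI.exists_affine z W hzW
  let R := Γ(A.base.left, V.1)
  let j : Spec R ⟶ A.base.left := V.2.fromSpec
  let e : Spec R ⟶ A.tors.total := V.2.isoSpec.inv ≫ A.base.left.homOfLE hVW ≫ e₀
  have hj : IsOpenImmersion j := V.2.isOpenImmersion_fromSpec
  have he : e ≫ A.tors.proj = j := by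
    simp only [e, Category.assoc, he₀, Scheme.homOfLE_ι]
    rfl
  obtain ⟨f, hf⟩ : ∃ f : R, (Scheme.ΓSpecIso R).inv.hom f = e.appTop.hom A.tors.fn :=
    ⟨(Scheme.ΓSpecIso R).hom.hom (e.appTop.hom A.tors.fn), by simp⟩
  let q : Spec (.of (R ⧸ Ideal.span {f})) ⟶ Spec R :=
    Spec.map (CommRingCat.ofHom (Ideal.Quotient.mk (Ideal.span {f})))
  have hq₀ : (q ≫ e).appTop.hom A.tors.fn = 0 := by
    rw [appTop_comp_apply, ← hf, spec_quotient_appTop,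
      Ideal.Quotient.eq_zero_iff_mem.mpr (Ideal.mem_span_singleton_self f), map_zero]
  obtain ⟨k, hk⟩ := (hs.factors_iff _).mpr hq₀
  rw [Category.assoc, he] at hk
  have : IsClosedImmersion q := IsClosedImmersion.spec_of_surjective _ Ideal.Quotient.mk_surjective
  -- The section `e` identifies the zeros of `f` with the points of `Spec R` in the divisor.
  have hP : IsPullback k q I.subschemeι j := by
    have hl (s : PullbackCone I.subschemeι j) : ∃ l : s.pt ⟶ _, l ≫ q = s.snd := by
      refine exists_lift_spec_quotient f s.snd ?_
      rw [hf, ← appTop_comp_apply, ← hs.factors_iff]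
      exact ⟨s.fst, by rw [s.condition, Category.assoc, he]⟩
    choose l hl using hl
    refine ⟨⟨hk⟩, ⟨PullbackCone.IsLimit.mk _ l (fun s => ?_) hl fun s m _ hm => ?_⟩⟩
    · rw [← cancel_mono I.subschemeι, Category.assoc, hk, ← Category.assoc, hl, s.condition]
    · rw [← cancel_mono q, hm, hl]
  have : IsOpenImmersion k := MorphismProperty.of_isPullback hP.flip inferInstance
  let φ : .of ℂ ⟶ R := Spec.preimage (j ≫ A.base.hom)
  have hφ : Spec.map φ = j ≫ A.base.hom := Spec.map_preimage _
  have hφs : φ.hom.Smooth := by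
    rw [← HasRingHomProperty.Spec_iff (P := @Smooth), hφ]
    infer_instance
  have hφf : ((Ideal.Quotient.mk (Ideal.span {f})).comp φ.hom).Smooth := by
    change (φ ≫ CommRingCat.ofHom (Ideal.Quotient.mk (Ideal.span {f}))).hom.Smooth
    rw [← HasRingHomProperty.Spec_iff (P := @Smooth), Spec.map_comp, hφ]
    change Smooth (q ≫ j ≫ A.base.hom)
    rw [← Category.assoc, ← hk, Category.assoc]
    infer_instance
  -- The ideal of the divisor contains a regular element `h`, and `h` is a multiple of `f`.
  have hfn : f ∈ nonZeroDivisors R := by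
    have h₁ : h ∈ Ideal.span {f} := IsAffineOpen.mem_span_singleton_of_le_ker V f hhI
      ((factors_iff_le_ker I _).mp ⟨k, hk⟩)
    obtain ⟨v, rfl⟩ := Ideal.mem_span_singleton.mp h₁
    exact (mul_mem_nonZeroDivisors.mp hh).1
  -- The trivialization of the torsor given by the section `e`.
  let t : specGm R ⟶ A.tors.total := A.tors.act (specGmCoord R) (specGmProj R ≫ e)
  have ht : t ≫ A.tors.proj = specGmProj R ≫ j := by
    rw [A.tors.act_proj, Category.assoc, he]
  have hact {Z : Scheme.{0}} (c : Γ(Z, ⊤)ˣ) (r : Z ⟶ specGm R) :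
      specGmLift (r ≫ specGmProj R) (c * pullUnit r (specGmCoord R)) ≫ t =
        A.tors.act c (r ≫ t) := by
    rw [A.tors.comp_act, pullUnit_specGmLift, ← Category.assoc, specGmLift_proj, A.tors.mul_act,
      A.tors.comp_act, Category.assoc]
  refine ⟨R, j, t, hj, ?_, ?_, ?_⟩
  · exact V.2.range_fromSpec.ge hzV
  · exact ((trivialTorsor R).isPullback_of_equivariant A.tors.toGmTorsor j t ht hact).flip
  · have h₁ : t ≫ A.fnMap = AffineSpace.homOfVector (n := PUnit.{1}) (specGmProj R ≫ Spec.map φ)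
        fun _ => (Scheme.ΓSpecIso (.of R[T;T⁻¹])).inv.hom (T 1 * C f) := by
      rw [A.comp_fnMap, ← Category.assoc, ht, Category.assoc, hφ]
      congr 1
      funext _
      rw [A.tors.act_fn, appTop_comp_apply, ← hf, map_mul]
      congr 1
      exact (ConcreteCategory.congr_hom (Scheme.ΓSpecIso_inv_naturality
        (CommRingCat.ofHom (C (R := R)))) f).symm
    rw [h₁]
    exact smooth_homOfVector_of_smooth_quotient φ hφs f hfn hφf

/-- If the zero scheme is a smooth Cartier divisor on a smooth base then the function on the torsor
is smooth over `𝔸¹`. -/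
theorem smooth_fnMap (A : A1GmObj) {I : A.base.left.IdealSheafData}
    (hI : IsEffectiveCartierIdeal I) (hs : A.HasZeroScheme I)
    [Smooth A.base.hom] [Smooth (I.subschemeι ≫ A.base.hom)] : Smooth A.fnMap := by
  choose R j t hj hz ht hts using exists_smooth_chart A hI hs
  have : IsZariskiLocalAtSource @Smooth.{0} :=
    HasRingHomProperty.instIsZariskiLocalAtSource (P := @Smooth.{0})
  have hto (z : A.base.left) : IsOpenImmersion (t z) :=
    MorphismProperty.of_isPullback (ht z).flip (hj z)
  refine IsZariskiLocalAtSource.of_iSup_eq_top (P := @Smooth) (fun z => (t z).opensRange) ?_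
    fun z => ?_
  · refine eq_top_iff.mpr fun p _ => TopologicalSpace.Opens.mem_iSup.mpr ⟨A.tors.proj p, ?_⟩
    change p ∈ Set.range (t (A.tors.proj p))
    rw [← (ht (A.tors.proj p)).isoPullback_hom_fst, Scheme.Hom.comp_base, TopCat.coe_comp,
      Set.range_comp, Set.range_eq_univ.mpr (Scheme.Hom.surjective _), Set.image_univ,
      Scheme.Pullback.range_fst]
    exact hz _
  · rw [← Scheme.Hom.isoOpensRange_inv_comp (t z), Category.assoc]
    infer_instance

end

/-! ### Smoothness of the zero scheme -/

/-- A scheme that is locally a retract of a smooth scheme is smooth. -/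
theorem smooth_of_locally_retract {D W T : Scheme.{0}} (f : D ⟶ T)
    [LocallyOfFinitePresentation f] (k : W ⟶ D) [Smooth (k ≫ f)]
    (h : ∀ d : D, ∃ V : D.Opens, d ∈ V ∧ ∃ m : V.toScheme ⟶ W, m ≫ k = V.ι) : Smooth f := by
  rw [← Scheme.Hom.smoothLocus_eq_top_iff, eq_top_iff]
  rintro d -
  obtain ⟨V, hd, m, hm⟩ := h d
  have key (x : V.toScheme) : (f.stalkMap (k (m x))).hom.FormallySmooth := by
    refine RingHom.FormallySmooth.of_retract (g := (k.stalkMap (m x)).hom)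
      (h := (m.stalkMap x).hom) ?_ ?_
    · have h₁ : m x ∈ (k ≫ f).smoothLocus := by
        rw [Scheme.Hom.smoothLocus_eq_top]; trivial
      rw [Scheme.Hom.mem_smoothLocus, Scheme.Hom.stalkMap_comp] at h₁
      exact h₁
    · have h₁ : IsIso ((m ≫ k).stalkMap x) := by
        rw [hm]
        infer_instance
      -- The composition of the stalk maps of `k` and `m` is the stalk map of an open immersion.
      have h₂ := ConcreteCategory.bijective_of_isIso ((m ≫ k).stalkMap x)
      rw [Scheme.Hom.stalkMap_comp] at h₂
      exact h₂
  let x : V.toScheme := ⟨d, hd⟩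
  have hx : k (m x) = d := by
    have h₁ : (m ≫ k) x = V.ι x := by rw [hm]
    exact h₁
  rw [Scheme.Hom.mem_smoothLocus, ← hx]
  exact key x

/-- If the function of `w` is zero then a morphism from `w` to `A` takes the base of `w` into the
zero scheme. -/
theorem exists_factorization_of_fn_eq_zero (A : A1GmObj) {I : A.base.left.IdealSheafData}
    (hs : A.HasZeroScheme I)
    {w : A1GmObj} (a : w ⟶ A) (hw : w.tors.fn = 0) :
    ∃ k : w.base.left ⟶ I.subscheme, k ≫ I.subschemeι = a.base.left := by
  obtain ⟨k, hk⟩ := (hs.factors_iff a.top).mpr (a.top_fn.trans hw)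
  rw [a.top_proj] at hk
  obtain ⟨k', hk'⟩ := w.tors.exists_descent k fun c q => by
    rw [← cancel_mono I.subschemeι, Category.assoc, Category.assoc, hk, ← Category.assoc,
      w.tors.act_proj, Category.assoc]
  exact ⟨k', w.tors.proj_cancel (by rw [← Category.assoc, hk', hk])⟩

/-- A section of the torsor of `A` on which the function of `A` vanishes is a point with values in
the product of `A` and the zero section. -/
theorem exists_lift_of_section (A : A1GmObj) {w : A1GmObj} {a : w ⟶ A}
    {b : w ⟶ zeroSectionObj (.of ℂ) (𝟙 _)} (hw : IsLimit (BinaryFan.mk a b)) {S : Scheme.{0}}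
    (s : S ⟶ A.tors.total) (hs : s.appTop.hom A.tors.fn = 0) :
    ∃ m : S ⟶ w.base.left, m ≫ a.base.left = s ≫ A.tors.proj := by
  let y : A1GmObj := zeroSectionObj (.of ℂ) (𝟙 _)
  let e : S ⟶ y.tors.total := specGmLift (s ≫ A.tors.proj ≫ A.base.hom) 1
  have he : e ≫ y.tors.proj = s ≫ A.tors.proj ≫ A.base.hom := specGmLift_proj _ _
  have h : s ≫ A.fnMap = e ≫ y.fnMap := by
    rw [A1GmObj.comp_fnMap_eq_iff]
    refine ⟨?_, hs.trans (map_zero _).symm⟩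
    rw [← Category.assoc e, he]
    exact (Category.comp_id _).symm
  -- The isomorphism from the trivial torsor to the pullback of the torsor of `A` to `S` that takes
  -- the unit section to `s`; it respects the functions because both vanish.
  let φ : IsomPoint A y S := .ofSection e s h
  obtain ⟨a', ha'⟩ := φ.exists_hom
  let m : φ.obj ⟶ w := hw.lift (BinaryFan.mk a' φ.snd)
  have hm : m ≫ a = a' := hw.fac (BinaryFan.mk a' φ.snd) ⟨WalkingPair.left⟩
  refine ⟨m.base.left, ?_⟩
  have h₁ : 𝟙 S ≫ φ.base = (𝟙 S ≫ e) ≫ y.tors.proj := by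
    rw [Category.id_comp, Category.id_comp]; rfl
  have h₂ := IsomPoint.eval_ofSection e s h (𝟙 S) h₁
  let f : S ⟶ A.base.left := a'.base.left
  have h₃ : φ.map ≫ A.tors.proj = pullback.fst φ.base y.tors.proj ≫ f := by
    rw [← ha']
    exact a'.top_proj
  have h₄ : m.base.left ≫ a.base.left = a'.base.left := by
    rw [← hm]
    rfl
  have h₅ : φ.eval (𝟙 S) (𝟙 S ≫ e) h₁ ≫ A.tors.proj = f := by
    rw [IsomPoint.eval, Category.assoc, h₃, pullback.lift_fst_assoc, Category.id_comp]
  refine h₄.trans (h₅.symm.trans ?_)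
  rw [h₂, Category.id_comp]

/-- The base of the product of `A` with the zero section over `Spec ℂ` is smooth over `ℂ` and maps
to the zero scheme. Local sections of the torsor of `A` make the zero scheme locally a retract of
it. -/
theorem smooth_subscheme_of_isRepresentableWith (A : A1GmObj) {I : A.base.left.IdealSheafData}
    (hs : A.HasZeroScheme I)
    [Smooth A.base.hom] (h : IsRepresentableWith (𝒳 := A1ModGm) @Smooth A) :
    Smooth (I.subschemeι ≫ A.base.hom) := by
  obtain ⟨w, a, b, ⟨hw⟩, hb⟩ := h (zeroSectionObj (.of ℂ) (𝟙 _))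
  change A1GmObj at w
  change w ⟶ A at a
  change w ⟶ zeroSectionObj (.of ℂ) (𝟙 _) at b
  change Smooth b.base.left at hb
  obtain ⟨k, hk⟩ := exists_factorization_of_fn_eq_zero A hs a (b.top_fn.symm.trans (map_zero _))
  -- The divisor is locally of finite type over a field.
  have : LocallyOfFinitePresentation (I.subschemeι ≫ A.base.hom) :=
    LocallyOfFinitePresentation.iff_locallyOfFiniteType.mpr inferInstance
  have : Smooth (k ≫ I.subschemeι ≫ A.base.hom) := by
    have h₁ : k ≫ I.subschemeι ≫ A.base.hom = b.base.left := by
      rw [← Category.assoc, hk, Over.w, ← Over.w b.base]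
      exact Category.comp_id _
    rwa [h₁]
  refine smooth_of_locally_retract _ k fun d => ?_
  obtain ⟨V, hV, e, he⟩ := A.tors.local_section (I.subschemeι d)
  have h₁ : (I.subschemeι ⁻¹ᵁ V).ι ≫ I.subschemeι = ((I.subschemeι ∣_ V) ≫ e) ≫ A.tors.proj := by
    rw [Category.assoc, he, morphismRestrict_ι]
  obtain ⟨m, hm⟩ := exists_lift_of_section A hw ((I.subschemeι ∣_ V) ≫ e)
    ((hs.factors_iff _).mp ⟨_, h₁⟩)
  refine ⟨I.subschemeι ⁻¹ᵁ V, hV, m, ?_⟩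
  rw [← cancel_mono I.subschemeι, Category.assoc, hk, hm, h₁]

theorem isRepresentableWith_smooth_iff (A : A1GmObj) {I : A.base.left.IdealSheafData}
    (hI : IsEffectiveCartierIdeal I) (hs : A.HasZeroScheme I)
    [Smooth A.base.hom] : IsRepresentableWith (𝒳 := A1ModGm) @Smooth A ↔
      Smooth (I.subschemeι ≫ A.base.hom) := by
  refine ⟨smooth_subscheme_of_isRepresentableWith A hs, fun h B => ?_⟩
  have := smooth_fnMap A hI hs
  exact exists_isLimit_binaryFan A B

theorem mainTheorem12 (X : DMStack.{v, u}) (hX : X.IsSmooth)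
    (D : ClosedSubstack X) (hD : D.IsEffectiveCartier)
    (σ : X.fib ⥤ᵇ A1ModGm) (hσ : IsGivenByDivisor σ D) :
    IsSmoothMorphism σ ↔ D.IsSmooth := by
  refine forall_congr' fun x => forall_congr' fun hx => ?_
  -- The base of `σ.obj x` is only propositionally equal to the base of `x`.
  have key (A : A1GmObj) (T : SchC) (hT : A.base = T) (I : T.left.IdealSheafData)
      (hI : IsEffectiveCartierIdeal I) (hs : ∀ W : A.tors.total.affineOpens,
        (I.comap (A.tors.proj ≫ (eqToHom hT).left)).ideal W =
          Ideal.span {(A.tors.total.presheaf.map (homOfLE (le_top : W.1 ≤ ⊤)).op).hom A.tors.fn})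
      (h : Smooth T.hom) : IsRepresentableWith (𝒳 := A1ModGm) @Smooth A ↔
        Smooth (I.subschemeι ≫ T.hom) := by
    subst hT
    refine isRepresentableWith_smooth_iff A hI fun W => ?_
    rw [← hs W]
    congr 1
  exact key (torsorAt σ x) _ (σ.w_obj x) (D.ideal x) (hD x hx) (hσ x) (hX x hx)
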